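/- Let $m\in\mathbb Z$, $N\ge 1$, $M\ge 0$ be integers and put $n=m+N+M$. Index matrices in $gl(n-m)$ by $\{m,\dots,n-1\}$, let $\Lambda=(\delta_{i+1,j})$, and let $\vec x=(x_1,\dots,x_{n-m-1})$, $\vec y=(y_1,\dots,y_{n-m-1})$ be algebraically independent variables over $\mathbb C$. **Wave matrices.** Over the field $\mathbb C(\vec x,\vec y)$ there is exactly one pair of matrices $\hat W^{(\infty)}$ (lower triangular with unit diagonal) and $\hat W^{(0)}$ (upper triangular) that solves the 2-Toda initial value problem $W^{(0)}=W^{(\infty)}A$ with $A=I$, where $W^{(\infty)}=\hat W^{(\infty)}\exp\big[\sum_k x_k\Lambda^k\big]$ and $W^{(0)}=\hat W^{(0)}\exp\big[\sum_k y_k(\Lambda^T)^k\big]$. Write $\hat w^{(0)}_k(s)$ for the entry of $\hat W^{(0)}$ in row $s$ and column $s+k$, and let $\tau(s)=\det\big[a_{ij}(\vec x,\vec y)\big]_{m\le i,j\le s-1}$ with $(a_{ij}(\vec x,\vec y))=\exp\big[\sum_k x_k\Lambda^k\big]\,A\,\exp\big[-\sum_k y_k(\Lambda^T)^k\big]$.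 **Schur polynomials.** For partitions $\lambda,\mu$ with at most $N$ parts put $S_{\lambda/\mu}(\vec z)=\det\big[h_{\lambda_i-\mu_j+j-i}(\vec z)\big]_{1\le i,j\le N}$, where $h_p$ is the complete homogeneous symmetric polynomial ($h_p=0$ for $p<0$), and $S_\lambda=S_{\lambda/\emptyset}$. **Phase model.** Let $\mathbb F$ be the complex vector space with basis $|n_0,\dots,n_M\rangle$, $n_j\in\mathbb Z_{\ge0}$. Let $\phi_j^\dagger$ raise $n_j$ by one, and let $\phi_j$ lower $n_j$ by one, with $\phi_j|\dots,n_j=0,\dots\rangle=0$. Put $L_j(u)=\begin{pmatrix}u^{-1}&\phi_j^\dagger\\ \phi_j&u\end{pmatrix}$ and $L_M(u)\cdots L_0(u)=\begin{pmatrix}A(u)&B(u)\\ C(u)&D(u)\end{pmatrix}$. Let $|0\rangle=|0,\dots,0\rangle$, let $\langle0|$ be the functional giving the coefficient of $|0\rangle$, and let $|\Psi\rangle=B(u_1)\cdots B(u_N)|0\rangle$. **Statement.** Let $0\le k\le M$ and $s=m+N-1=n-M-1$. Then $\tau(s)\,\hat w^{(0)}_k(s)$ is a polynomial in $\vec x,\vec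 y$. For all nonzero complex numbers $u_1,\dots,u_N,v_2,\dots,v_N$, if one substitutes $x_j=\frac1j\sum_{i=1}^N u_i^{2j}$ and $-y_j=\frac1j\sum_{i=1}^N v_i^{-2j}$ for $1\le j\le N+M-1$ in this polynomial, and lets $v_1\to\infty$ in $\mathbb C$, then $$\lim_{v_1\to\infty}\tau(s)\,\hat w^{(0)}_k(s)=\sum_{(k)\subseteq\lambda\subseteq(M^{N-1},k)}S_\lambda(u_1^2,\dots,u_N^2)\,S_{\lambda/(k)}(v_2^{-2},\dots,v_N^{-2})=\left(\frac{\prod_{j=1}^N u_j}{\prod_{j=2}^N v_j}\right)^{M}\langle 0|\,\phi_k\,C(v_2)\cdots C(v_N)\,|\Psi\rangle .$$ -/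

import Mathlib

open Filter Topology

namespace TodaPhase

noncomputable section

/-! ### The finite 2-Toda hierarchy: wave matrices and tau-function

Matrices in `gl(n - m)` have rows and columns indexed by the integers `m, …, n - 1`. -/

/-- The index set `{m, …, n - 1}`. -/
abbrev Idx (m n : ℤ) : Type := Set.Ico m n

/-- The number `n - m - 1` of time variables in each of the two sets of times. -/
abbrev numTimes (m n : ℤ) : ℕ := (n - m - 1).toNat

/-- The shift matrix `Λ = (δ_{k+1,l})`. -/
def shift (m n : ℤ) (K : Type) [Field K] : Matrix (Idx m n) (Idx m n) K :=
  Matrix.of fun k l => if (k : ℤ) + 1 = (l : ℤ) then 1 else 0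

section Wave

variable {m n : ℤ} {K : Type} [Field K] [CharZero K]

/-- `exp (∑_{k=1}^{n-m-1} x_k Λ^k)`; the entry `x j` is the time `x_{j+1}`.
The exponent is nilpotent, so the exponential is a finite sum. -/
def expX (x : Fin (numTimes m n) → K) : Matrix (Idx m n) (Idx m n) K :=
  IsNilpotent.exp (∑ j, x j • (shift m n K) ^ ((j : ℕ) + 1))

/-- `exp (∑_{k=1}^{n-m-1} y_k (Λᵀ)^k)`; the entry `y j` is the time `y_{j+1}`. -/
def expY (y : Fin (numTimes m n) → K) : Matrix (Idx m n) (Idx m n) K :=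
  IsNilpotent.exp (∑ j, y j • (shift m n K).transpose ^ ((j : ℕ) + 1))

/-- `Ŵ^(∞)`, `Ŵ^(0)` solve the initial value problem with initial matrix `A` at the times `x, y`:
`Ŵ^(∞)` is lower triangular with unit diagonal, `Ŵ^(0)` is upper triangular, and
`W^(0) = W^(∞) A` where `W^(∞) = Ŵ^(∞) exp (∑ x_k Λ^k)` and
`W^(0) = Ŵ^(0) exp (∑ y_k (Λᵀ)^k)`. -/
structure IsWavePair (A : Matrix (Idx m n) (Idx m n) K) (x y : Fin (numTimes m n) → K)
    (Winf Wzero : Matrix (Idx m n) (Idx m n) K) : Prop where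
  inf_diag : ∀ i, Winf i i = 1
  inf_lower : ∀ i j, i < j → Winf i j = 0
  zero_upper : ∀ i j, j < i → Wzero i j = 0
  initial_value : Wzero * expY y = (Winf * expX x) * A

/-- The matrix `(a_{ij}(x, y)) = exp (∑ x_k Λ^k) A exp (-∑ y_k (Λᵀ)^k)`. -/
def evolved (A : Matrix (Idx m n) (Idx m n) K) (x y : Fin (numTimes m n) → K) :
    Matrix (Idx m n) (Idx m n) K :=
  expX x * A * expY (-y)

/-- The tau-function `τ(s, x, y) = det [a_{ij}(x, y)]_{m ≤ i, j ≤ s - 1}`. -/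
def tau (A : Matrix (Idx m n) (Idx m n) K) (x y : Fin (numTimes m n) → K) (s : ℤ) : K :=
  ((evolved A x y).submatrix
    (fun i : {i : Idx m n // (i : ℤ) < s} => i.1)
    (fun i : {i : Idx m n // (i : ℤ) < s} => i.1)).det

end Wave

/-- Polynomials over `ℂ` in the `2 (n - m - 1)` algebraically independent time variables. -/
abbrev TimePoly (m n : ℤ) : Type :=
  MvPolynomial (Fin (numTimes m n) ⊕ Fin (numTimes m n)) ℂ

/-- Rational functions in the algebraically independent time variables. -/
abbrev TimeField (m n : ℤ) : Type := FractionRing (TimePoly m n)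

/-- The independent time variables `x_1, …, x_{n-m-1}`. -/
def xVar (m n : ℤ) : Fin (numTimes m n) → TimeField m n := fun j =>
  algebraMap (TimePoly m n) (TimeField m n) (MvPolynomial.X (Sum.inl j))

/-- The independent time variables `y_1, …, y_{n-m-1}`. -/
def yVar (m n : ℤ) : Fin (numTimes m n) → TimeField m n := fun j =>
  algebraMap (TimePoly m n) (TimeField m n) (MvPolynomial.X (Sum.inr j))

/-- The scaled power sums `p_k(z_1, …, z_N) / k` for `k = 1, …, d`, the entry at `j` being that
for `k = j + 1`. -/
def powerTimes {N : ℕ} (d : ℕ) (z : Fin N → ℂ) : Fin d → ℂ := fun j =>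
  (∑ i, z i ^ ((j : ℕ) + 1)) / (((j : ℕ) + 1 : ℕ) : ℂ)

/-- Substitution of `x_k = p_k(u_1², …, u_N²) / k` and `-y_k = p_k(v_1⁻², …, v_N⁻²) / k`
in a polynomial in the time variables. -/
def restrictTimes {m n : ℤ} {N : ℕ} (u v : Fin N → ℂ) (P : TimePoly m n) : ℂ :=
  MvPolynomial.eval
    (Sum.elim (powerTimes (numTimes m n) fun i => u i ^ 2)
      (-powerTimes (numTimes m n) fun i => (v i ^ 2)⁻¹)) P

/-! ### Skew Schur polynomials -/

/-- The complete homogeneous symmetric polynomial `h_r(z_1, …, z_p)`, which is `0` for `r < 0`. -/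
def completeSymm {p : ℕ} (z : Fin p → ℂ) (r : ℤ) : ℂ :=
  if 0 ≤ r then MvPolynomial.aeval z (MvPolynomial.hsymm (Fin p) ℂ r.toNat) else 0

/-- The skew Schur polynomial `S_{λ/μ}(z_1, …, z_p) = det [h_{λ_i - μ_j + j - i}(z)]_{i, j ≤ N}` for
partitions `λ`, `μ` with at most `N` nonzero parts. -/
def skewSchur {N p : ℕ} (lam mu : Fin N → ℕ) (z : Fin p → ℂ) : ℂ :=
  (Matrix.of fun i j : Fin N =>
    completeSymm z ((lam i : ℤ) - (mu j : ℤ) + (j : ℤ) - (i : ℤ))).det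

/-- The Schur polynomial `S_λ = S_{λ/∅}`. -/
def schur {N p : ℕ} (lam : Fin N → ℕ) (z : Fin p → ℂ) : ℂ := skewSchur lam (fun _ => 0) z

/-- The partition `(k) = (k, 0, …, 0)`, written with `r + 1` parts. -/
def oneRow (r k : ℕ) : Fin (r + 1) → ℕ := Fin.cons k fun _ => 0

/-- The partition `(M^r, k) = (M, …, M, k)`, written with `r + 1` parts. -/
def nearRectangle (r M k : ℕ) : Fin (r + 1) → ℕ := Fin.snoc (α := fun _ => ℕ) (fun _ => M) k

/-- The partitions `λ` with `(k) ⊆ λ ⊆ (M^r, k)`. -/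
def boundaryPartitions (r M k : ℕ) : Finset (Fin (r + 1) → ℕ) :=
  {lam ∈ Finset.Icc (oneRow r k) (nearRectangle r M k) | Antitone lam}

/-! ### The phase model -/

/-- The Fock space `F_0 ⊗ ⋯ ⊗ F_M`, with basis `|n_0, …, n_M⟩` indexed by occupation numbers. -/
abbrev Fock (M : ℕ) : Type := (Fin (M + 1) → ℕ) →₀ ℂ

/-- `φ_j`: lowers the `j`-th occupation number, and kills states whose `j`-th site is empty. -/
def phi {M : ℕ} (j : Fin (M + 1)) : Module.End ℂ (Fock M) :=
  Finsupp.linearCombination ℂ fun occ : Fin (M + 1) → ℕ =>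
    if occ j = 0 then (0 : Fock M) else Finsupp.single (Function.update occ j (occ j - 1)) 1

/-- `φ_j†`: raises the `j`-th occupation number. -/
def phiDag {M : ℕ} (j : Fin (M + 1)) : Module.End ℂ (Fock M) :=
  Finsupp.linearCombination ℂ fun occ : Fin (M + 1) → ℕ =>
    (Finsupp.single (Function.update occ j (occ j + 1)) 1 : Fock M)

/-- The local `L`-operator matrix `L_j(u)`. -/
def Lop {M : ℕ} (u : ℂ) (j : Fin (M + 1)) : Matrix (Fin 2) (Fin 2) (Module.End ℂ (Fock M)) :=
  !![u⁻¹ • 1, phiDag j; phi j, u • 1]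

/-- The monodromy matrix `T(u) = L_M(u) L_{M-1}(u) ⋯ L_0(u)`. -/
def monodromy (M : ℕ) (u : ℂ) : Matrix (Fin 2) (Fin 2) (Module.End ℂ (Fock M)) :=
  (List.ofFn fun j : Fin (M + 1) => Lop u j.rev).prod

/-- The creation operator `B(u)`. -/
def opB (M : ℕ) (u : ℂ) : Module.End ℂ (Fock M) := monodromy M u 0 1

/-- The annihilation operator `C(u)`. -/
def opC (M : ℕ) (u : ℂ) : Module.End ℂ (Fock M) := monodromy M u 1 0

/-- The vacuum expectation value `⟨0| X |0⟩`. -/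
def vev {M : ℕ} (X : Module.End ℂ (Fock M)) : ℂ :=
  X (Finsupp.single (fun _ => 0) 1) (fun _ => 0)

/-- The boundary correlation function `⟨0| φ_k C(v_2) ⋯ C(v_N) B(u_1) ⋯ B(u_N) |0⟩` for
`N = r + 1`; the entry `w i` is `v_{i+2}`. -/
def boundaryCorrelation {r : ℕ} (M : ℕ) (k : Fin (M + 1)) (u : Fin (r + 1) → ℂ) (w : Fin r → ℂ) :
    ℂ :=
  vev (phi k * (List.ofFn fun i => opC M (w i)).prod * (List.ofFn fun i => opB M (u i)).prod)

end

end TodaPhase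

/-!
Both sides of the identity are the sum of `S_λ(u²) S_{λ/(k)}(v⁻²)` over partitions `λ` in the
`(r + 1) × M` box, and the restriction to partitions inside `(M^r, k)` is automatic in the limit.

**Toda side.** The initial value problem is the lower-upper factorization of the matrix
`exp (∑ x_k Λ^k) exp (-∑ y_k (Λᵀ)^k)`. It exists and is unique because the leading principal
minors are nonzero polynomials, being equal to `1` at time zero
(`existsUnique_lowerUpper`, `det_leadingBlock_evolved_ne_zero`). Row operations show that
`τ(s) ŵ_k(s)` is a bordered minor of that matrix (`det_leadingBlock_mul_upper`), hence a
polynomial, `boundaryPoly`. The two exponentials are triangular Toeplitz matrices of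
`exp (∑ x_k t^k)` and of `exp (-∑ y_k t^k)`, and at power sums the coefficients of these series are
complete homogeneous symmetric polynomials, by Newton's identities
(`coeff_timeExp_powerTimes`). The Cauchy–Binet formula then expands the minor as the sum
above, with both alphabets of `r + 1` variables (`restrictTimes_boundaryPoly`). Letting `v₁ → ∞`
removes one of the variables `v_i⁻²`.

**Branching.** The Toeplitz matrix of a union of alphabets is the product of the Toeplitz matrices,
so Cauchy–Binet also gives the branching rule `skewSchur_cons`. For a single variable, `S_{λ/μ}(z)`
is `z^{|λ| - |μ|}` if `λ / μ` is a horizontal strip and zero otherwise (`skewSchur_single`).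
Consequently `S_{λ/(k)}` in `r` variables vanishes unless the last of the `r + 1` parts of `λ` is at
most `k` (`le_of_skewSchur_ne_zero`).

**Phase model.** Matrix elements of the monodromy matrix factorize over the sites into a product of
scalar `2 × 2` matrices, in which only one path in the auxiliary space contributes. Reading a state
as a partition with one part `j` for each particle at site `j`, the state of the auxiliary space
at site `q` counts the boxes added in column `q`, so that `B(u)` adds a horizontal strip with weight
`u^{2(|λ| - |μ|) - M}` (`opB_single_occupation`). This is the branching rule, and
`C(u)` is the transpose of `B(u⁻¹)`, so the correlation function is the sum above, with the
alphabets `u²` and `v₂⁻², …, v_N⁻²` (`boundaryCorrelation_eq`).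
-/

namespace TodaPhase

noncomputable section

/-! ### The Cauchy–Binet formula -/

section CauchyBinet

open Equiv

variable {N : ℕ} {L R : Type*} [Fintype L] [CommRing R]

theorem det_mul_eq_sum_fun (A : Matrix (Fin N) L R) (B : Matrix L (Fin N) R) :
    (A * B).det = ∑ f : Fin N → L, (∏ i, A i (f i)) * (B.submatrix f id).det := by
  have h : A * B = fun i => ∑ l, A i l • B l := by
    ext i j
    simp [Matrix.mul_apply, Finset.sum_apply]
  rw [h]
  refine ((Matrix.detRowAlternating (n := Fin N) (R := R)).toMultilinearMap.map_sum
    (fun i l => A i l • B l)).trans ?_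
  refine Finset.sum_congr rfl fun f _ => ?_
  exact (Matrix.detRowAlternating (n := Fin N) (R := R)).toMultilinearMap.map_smul_univ
    (fun i => A i (f i)) (fun i => B (f i))

variable [LinearOrder L]

open scoped Classical in
/-- The Cauchy–Binet formula; the `N`-element subsets of `L` are written as strictly increasing
functions. -/
theorem cauchyBinet_strictMono (A : Matrix (Fin N) L R) (B : Matrix L (Fin N) R) :
    (A * B).det = ∑ f : Fin N → L with StrictMono f,
      (A.submatrix id f).det * (B.submatrix f id).det := by
  have hinj : (A * B).det = ∑ f : Fin N → L with Function.Injective f,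
      (∏ i, A i (f i)) * (B.submatrix f id).det := by
    rw [det_mul_eq_sum_fun]
    refine (Finset.sum_subset (Finset.filter_subset _ _) fun f _ hf => ?_).symm
    obtain ⟨i, j, hij, hne⟩ : ∃ i j, f i = f j ∧ i ≠ j := by
      rw [Finset.mem_filter_univ, Function.Injective] at hf
      push Not at hf
      exact hf
    rw [Matrix.det_zero_of_row_eq hne, mul_zero]
    ext; simp [hij]
  rw [hinj]
  have hexp : ∀ f : Fin N → L, (A.submatrix id f).det * (B.submatrix f id).det =
      ∑ σ : Perm (Fin N), (∏ i, A i (f (σ i))) * (B.submatrix (f ∘ σ) id).det := by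
    intro f
    rw [← Matrix.det_transpose, Matrix.det_apply', Finset.sum_mul]
    refine Finset.sum_congr rfl fun σ _ => ?_
    have := Matrix.det_permute σ (B.submatrix f id)
    rw [Matrix.submatrix_submatrix] at this
    simp only [Function.comp_id] at this
    rw [this]
    simp only [Matrix.transpose_apply, Matrix.submatrix_apply, id]
    ring
  simp_rw [hexp]
  rw [← Finset.sum_product']
  symm
  refine Finset.sum_bij (fun p _ => p.1 ∘ p.2) ?_ ?_ ?_ ?_
  · rintro ⟨f, σ⟩ h
    simp only [Finset.mem_product, Finset.mem_filter_univ, Finset.mem_univ, and_true] at h ⊢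
    exact h.injective.comp σ.injective
  · rintro ⟨f, σ⟩ hf ⟨g, τ⟩ hg h
    simp only [Finset.mem_product, Finset.mem_filter_univ, Finset.mem_univ, and_true] at hf hg h
    have hfg : f = g := by
      rw [← StrictMono.range_inj hf hg, ← σ.surjective.range_comp f, ← τ.surjective.range_comp g, h]
    subst hfg
    have : σ = τ := by
      ext i
      exact congrArg Fin.val (hf.injective (congrFun h i))
    rw [this]
  · intro f hf
    rw [Finset.mem_filter_univ] at hf
    refine ⟨(f ∘ Tuple.sort f, (Tuple.sort f)⁻¹), ?_, ?_⟩
    · simp only [Finset.mem_product, Finset.mem_filter_univ, Finset.mem_univ, and_true]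
      exact (Tuple.monotone_sort f).strictMono_of_injective (hf.comp (Tuple.sort f).injective)
    · ext i; simp
  · rintro ⟨f, σ⟩ _
    rfl

open scoped Classical in
theorem cauchyBinet_strictAnti (A : Matrix (Fin N) L R) (B : Matrix L (Fin N) R) :
    (A * B).det = ∑ f : Fin N → L with StrictAnti f,
      (A.submatrix id f).det * (B.submatrix f id).det := by
  refine (cauchyBinet_strictMono (L := Lᵒᵈ) (A : Matrix (Fin N) Lᵒᵈ R) B).trans ?_
  refine Finset.sum_congr (Finset.ext fun f => ?_) fun _ _ => rfl
  exact (Finset.mem_filter_univ f).trans ((strictMono_toDual_comp_iff (β := L) (f := f)).trans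
    (Finset.mem_filter_univ (p := fun g : Fin N → L => StrictAnti g) f).symm)

end CauchyBinet

/-! ### Toeplitz matrices of power series -/

section Toeplitz

open PowerSeries

variable {R : Type*} [CommRing R]

/-- The coefficient of a power series at an integer, zero at negative integers. -/
def intCoeff (f : R⟦X⟧) (p : ℤ) : R := if 0 ≤ p then coeff p.toNat f else 0

theorem intCoeff_natCast (f : R⟦X⟧) (p : ℕ) : intCoeff f p = coeff p f := by simp [intCoeff]

theorem intCoeff_of_neg (f : R⟦X⟧) {p : ℤ} (h : p < 0) : intCoeff f p = 0 := by
  simp [intCoeff, h]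

theorem intCoeff_one (p : ℤ) : intCoeff (1 : R⟦X⟧) p = if p = 0 then 1 else 0 := by
  rcases lt_or_ge p 0 with h | h
  · rw [intCoeff_of_neg _ h, if_neg h.ne]
  · lift p to ℕ using h
    rw [intCoeff_natCast, coeff_one]
    simp

/-- The lower triangular Toeplitz matrix of a power series, as an algebra homomorphism. -/
def toeplitz (m n : ℤ) (R : Type*) [CommRing R] :
    R⟦X⟧ →ₐ[R] Matrix (Idx m n) (Idx m n) R :=
  AlgHom.ofLinearMap
    { toFun := fun f => Matrix.of fun a b => intCoeff f ((a : ℤ) - b)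
      map_add' := fun f g => by
        ext a b
        simp only [Matrix.of_apply, Matrix.add_apply, intCoeff]
        split <;> simp
      map_smul' := fun c f => by
        ext a b
        simp only [Matrix.of_apply, Matrix.smul_apply, intCoeff]
        split <;> simp }
    (by
      ext a b
      simp only [LinearMap.coe_mk, AddHom.coe_mk, Matrix.of_apply, intCoeff_one, Matrix.one_apply,
        sub_eq_zero, Subtype.ext_iff])
    (by
      intro f g
      ext a b
      simp only [LinearMap.coe_mk, AddHom.coe_mk, Matrix.of_apply, Matrix.mul_apply]
      rcases lt_or_ge (a : ℤ) b with h | h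
      · rw [intCoeff_of_neg _ (by omega)]
        symm
        refine Finset.sum_eq_zero fun c _ => ?_
        rcases lt_or_ge (a : ℤ) c with h' | h'
        · rw [intCoeff_of_neg _ (by omega), zero_mul]
        · rw [intCoeff_of_neg g (by omega), mul_zero]
      · obtain ⟨d, hd⟩ : ∃ d : ℕ, (a : ℤ) - b = d := ⟨((a : ℤ) - b).toNat, by omega⟩
        rw [hd, intCoeff_natCast, coeff_mul]
        have hb := b.2.1
        have ha := a.2.2
        refine Finset.sum_of_injOn (fun p => if h : (b : ℤ) + p.2 < n
            then (⟨b + p.2, by constructor <;> omega⟩ : Idx m n) else b) ?_ (by simp) ?_ ?_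
        · intro p hp q hq h
          rw [Finset.mem_coe, Finset.HasAntidiagonal.mem_antidiagonal] at hp hq
          simp only at h
          rw [dif_pos (by omega), dif_pos (by omega)] at h
          have := congrArg Subtype.val h
          simp only at this
          ext <;> omega
        · intro c _ hc
          by_contra hne
          apply hc
          have h1 : (c : ℤ) ≤ a := by
            by_contra h'
            exact hne (by rw [intCoeff_of_neg f (by omega), zero_mul])
          have h2 : (b : ℤ) ≤ c := by
            by_contra h'
            exact hne (by rw [intCoeff_of_neg g (by omega), mul_zero])
          refine ⟨(((a : ℤ) - c).toNat, ((c : ℤ) - b).toNat), ?_, ?_⟩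
          · rw [Finset.mem_coe, Finset.HasAntidiagonal.mem_antidiagonal]
            omega
          · have hc := c.2.2
            simp only
            rw [dif_pos (by omega)]
            ext
            simp only
            omega
        · intro p hp
          rw [Finset.HasAntidiagonal.mem_antidiagonal] at hp
          rw [dif_pos (by omega)]
          simp only
          rw [show (a : ℤ) - (b + p.2) = (p.1 : ℕ) by omega,
            show (b : ℤ) + p.2 - b = (p.2 : ℕ) by omega, intCoeff_natCast, intCoeff_natCast])

theorem toeplitz_apply (m n : ℤ) (f : R⟦X⟧) (a b : Idx m n) :
    toeplitz m n R f a b = intCoeff f ((a : ℤ) - b) := rfl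

end Toeplitz

/-! ### Complete homogeneous symmetric polynomials -/

section CompleteSymm

open PowerSeries

/-- The generating series `∑ₙ hₙ(z) tⁿ`. -/
def completeSeries {p : ℕ} (z : Fin p → ℂ) : ℂ⟦X⟧ :=
  PowerSeries.mk fun k => MvPolynomial.aeval z (MvPolynomial.hsymm (Fin p) ℂ k)

theorem completeSymm_eq_intCoeff {p : ℕ} (z : Fin p → ℂ) (q : ℤ) :
    completeSymm z q = intCoeff (completeSeries z) q := by
  simp [completeSymm, intCoeff, completeSeries]

theorem aeval_hsymm {σ : Type*} [Fintype σ] [DecidableEq σ] (z : σ → ℂ) (k : ℕ) :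
    MvPolynomial.aeval z (MvPolynomial.hsymm σ ℂ k) =
      ∑ s : Sym σ k, ((s : Multiset _).map z).prod := by
  simp only [MvPolynomial.hsymm, map_sum]
  refine Finset.sum_congr rfl fun s _ => ?_
  rw [map_multiset_prod, Multiset.map_map]
  simp

/-- A multiset of size `k + 1` either contains the first variable, or avoids it. -/
theorem sum_sym_option {σ : Type*} [Fintype σ] [DecidableEq σ] (z : Option σ → ℂ) (k : ℕ) :
    ∑ s : Sym (Option σ) (k + 1), ((s : Multiset _).map z).prod =
      z none * ∑ s : Sym (Option σ) k, ((s : Multiset _).map z).prod +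
        ∑ s : Sym σ (k + 1), ((s : Multiset _).map fun i => z (some i)).prod := by
  rw [← (symOptionSuccEquiv (α := σ) (n := k)).symm.sum_comp, Fintype.sum_sum_type, Finset.mul_sum]
  congr 1
  · refine Finset.sum_congr rfl fun s _ => ?_
    change (((none ::ₛ s : Sym (Option σ) (k + 1)) : Multiset _).map z).prod = _
    rw [Sym.coe_cons, Multiset.map_cons, Multiset.prod_cons]
  · refine Finset.sum_congr rfl fun s _ => ?_
    change (Multiset.map z (s.map Function.Embedding.some : Sym (Option σ) (k + 1))).prod = _
    rw [Sym.coe_map, Multiset.map_map]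
    rfl

theorem completeSeries_cons {p : ℕ} (z₀ : ℂ) (z : Fin p → ℂ) :
    (1 - PowerSeries.C z₀ * X) * completeSeries (Fin.cons z₀ z : Fin (p + 1) → ℂ) =
      completeSeries z := by
  ext k
  have hopt : ∀ k, MvPolynomial.aeval (Fin.cons z₀ z : Fin (p + 1) → ℂ)
      (MvPolynomial.hsymm (Fin (p + 1)) ℂ k) =
      ∑ s : Sym (Option (Fin p)) k, ((s : Multiset _).map fun o => Option.elim o z₀ z).prod := by
    intro k
    rw [← MvPolynomial.rename_hsymm (Option (Fin p)) ℂ k (finSuccEquiv p).symm,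
      MvPolynomial.aeval_rename, aeval_hsymm]
    congr! 4 with s _ o
    cases o <;> simp
  rcases k with _ | k
  · simp [completeSeries, sub_mul, mul_assoc]
  · rw [sub_mul, one_mul, mul_assoc, map_sub, coeff_C_mul, coeff_succ_X_mul]
    simp only [completeSeries, coeff_mk, hopt]
    rw [aeval_hsymm, sum_sym_option]
    simp

theorem completeSeries_zero (z : Fin 0 → ℂ) : completeSeries z = 1 := by
  ext k
  simp only [completeSeries, coeff_mk, aeval_hsymm]
  rcases k with _ | k
  · simp [Sym.eq_nil_of_card_zero]
  · simp [coeff_one]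

theorem one_sub_C_mul_X_ne_zero (c : ℂ) : (1 - PowerSeries.C c * X : ℂ⟦X⟧) ≠ 0 := by
  intro h
  simpa using congrArg (coeff 0) h

theorem one_sub_mul_completeSeries_single (z₀ : ℂ) :
    (1 - PowerSeries.C z₀ * X) * completeSeries (fun _ : Fin 1 => z₀) = 1 := by
  have h : (fun _ : Fin 1 => z₀) = Fin.cons z₀ (fun i : Fin 0 => i.elim0) := by
    funext i
    simp [Subsingleton.elim i 0]
  rw [h, completeSeries_cons, completeSeries_zero]

/-- Adding a variable multiplies the generating series by that of the variable. -/
theorem completeSeries_cons_eq_mul {p : ℕ} (z₀ : ℂ) (z : Fin p → ℂ) :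
    completeSeries (Fin.cons z₀ z : Fin (p + 1) → ℂ) =
      completeSeries (fun _ : Fin 1 => z₀) * completeSeries z := by
  apply mul_left_cancel₀ (one_sub_C_mul_X_ne_zero z₀)
  rw [completeSeries_cons, ← mul_assoc, one_sub_mul_completeSeries_single, one_mul]

theorem completeSeries_single (z₀ : ℂ) :
    completeSeries (fun _ : Fin 1 => z₀) = PowerSeries.mk fun k => z₀ ^ k := by
  apply mul_left_cancel₀ (one_sub_C_mul_X_ne_zero z₀)
  rw [one_sub_mul_completeSeries_single]
  ext k
  rcases k with _ | k
  · simp [sub_mul, mul_assoc]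
  · rw [sub_mul, one_mul, mul_assoc, map_sub, coeff_C_mul, coeff_succ_X_mul]
    simp [coeff_one, pow_succ']

theorem completeSymm_single (z₀ : ℂ) (q : ℤ) :
    completeSymm (fun _ : Fin 1 => z₀) q = if 0 ≤ q then z₀ ^ q.toNat else 0 := by
  rw [completeSymm_eq_intCoeff, completeSeries_single, intCoeff]
  simp

/-- Setting a variable equal to zero removes it. -/
theorem completeSymm_cons_zero {p : ℕ} (z : Fin p → ℂ) (q : ℤ) :
    completeSymm (Fin.cons 0 z : Fin (p + 1) → ℂ) q = completeSymm z q := by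
  have := completeSeries_cons 0 z
  rw [map_zero, zero_mul, sub_zero, one_mul] at this
  rw [completeSymm_eq_intCoeff, completeSymm_eq_intCoeff, this]

/-- Newton's identities `H' = H · ∑ₙ pₙ₊₁ tⁿ` for the generating series `H` of the complete
homogeneous symmetric polynomials. -/
theorem derivative_completeSeries {p : ℕ} (z : Fin p → ℂ) :
    derivative ℂ (completeSeries z) =
      completeSeries z * PowerSeries.mk fun k => ∑ i, z i ^ (k + 1) := by
  induction p with
  | zero =>
    rw [completeSeries_zero]
    ext k
    simp
  | succ p ih =>
    obtain ⟨z₀, z, rfl⟩ : ∃ z₀ z', z = Fin.cons z₀ z' :=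
      ⟨z 0, Fin.tail z, (Fin.cons_self_tail z).symm⟩
    have h := congrArg (derivative ℂ) (completeSeries_cons z₀ z)
    rw [ih z, ← completeSeries_cons z₀ z, Derivation.leibniz] at h
    have hsum : (PowerSeries.mk fun k => ∑ i, (Fin.cons z₀ z : Fin (p + 1) → ℂ) i ^ (k + 1)) =
        (PowerSeries.mk fun k => z₀ ^ (k + 1)) + PowerSeries.mk fun k => ∑ i, z i ^ (k + 1) := by
      ext k
      simp [Fin.sum_univ_succ]
    have hgeo : (1 - PowerSeries.C z₀ * X) * (PowerSeries.mk fun k => z₀ ^ (k + 1)) =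
        PowerSeries.C z₀ := by
      ext k
      rcases k with _ | k
      · simp [sub_mul, mul_assoc]
      · rw [sub_mul, one_mul, mul_assoc, map_sub, coeff_C_mul, coeff_succ_X_mul]
        simp [pow_succ']
    have hder : derivative ℂ (1 - PowerSeries.C z₀ * X : ℂ⟦X⟧) = -PowerSeries.C z₀ := by
      simp [Derivation.leibniz]
    rw [hder] at h
    apply mul_left_cancel₀ (one_sub_C_mul_X_ne_zero z₀)
    rw [hsum]
    simp only [smul_eq_mul] at h
    linear_combination h - completeSeries (Fin.cons z₀ z : Fin (p + 1) → ℂ) * hgeo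

theorem continuous_completeSymm {p : ℕ} (q : ℤ) :
    Continuous fun z : Fin p → ℂ => completeSymm z q := by
  unfold completeSymm
  split
  · simp only [MvPolynomial.aeval_eq_eval]
    exact MvPolynomial.continuous_eval _
  · exact continuous_const

end CompleteSymm

/-! ### Branching of skew Schur polynomials -/

section Branching

open PowerSeries

/-- The partitions with at most `N` parts, all at most `M`. -/
def boxPartitions (N M : ℕ) : Finset (Fin N → ℕ) :=
  {lam ∈ Finset.Icc (0 : Fin N → ℕ) (fun _ => M) | Antitone lam}

theorem mem_boxPartitions {N M : ℕ} {lam : Fin N → ℕ} :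
    lam ∈ boxPartitions N M ↔ (∀ i, lam i ≤ M) ∧ Antitone lam := by
  rw [boxPartitions, Finset.mem_filter, Finset.mem_Icc]
  simp [Pi.le_def]

open scoped Classical in
/-- Strictly decreasing sequences `f` in `{m, …, n - 1}` correspond to partitions `λ` in a box by
`f i = m + λ i + (N - 1 - i)`. -/
theorem sum_strictAnti_eq_sum_boxPartitions {R : Type*} [AddCommMonoid R] {m n : ℤ} {N M : ℕ}
    (hn : n = m + N + M) (F : (Fin N → ℤ) → R) :
    ∑ f : Fin N → Idx m n with StrictAnti f, F (fun i => f i) =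
      ∑ lam ∈ boxPartitions N M, F (fun i => m + lam i + ((N : ℤ) - 1 - i)) := by
  symm
  refine Finset.sum_bij (fun lam h i =>
    (⟨m + lam i + ((N : ℤ) - 1 - i), by
      have := (mem_boxPartitions.1 h).1 i
      have := i.2
      constructor <;> omega⟩ : Idx m n)) ?_ ?_ ?_ ?_
  · intro lam h
    rw [Finset.mem_filter_univ]
    intro i j hij
    have := (mem_boxPartitions.1 h).2 hij.le
    rw [Fin.lt_def] at hij
    change m + (lam j : ℤ) + ((N : ℤ) - 1 - j) < m + (lam i : ℤ) + ((N : ℤ) - 1 - i)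
    omega
  · intro lam _ mu _ h
    ext i
    have := congrArg Subtype.val (congrFun h i)
    simp only at this
    omega
  · intro f hf
    rw [Finset.mem_filter_univ] at hf
    -- a strictly decreasing integer sequence drops by at least one at each step
    have key : ∀ i j : Fin N, i ≤ j → (f j : ℤ) + ((j : ℤ) - i) ≤ f i := by
      intro i j hij
      obtain ⟨d, hd⟩ : ∃ d : ℕ, (j : ℕ) = i + d := ⟨j - i, by rw [Fin.le_def] at hij; omega⟩
      induction d generalizing j with
      | zero =>
        obtain rfl : i = j := by ext; omega
        omega
      | succ d ih =>
        have hj := j.2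
        have h1 := ih ⟨i + d, by omega⟩ (by rw [Fin.le_def]; simp) rfl
        have h2 : f j < f ⟨i + d, by omega⟩ := hf (by rw [Fin.lt_def]; simp only; omega)
        have h3 : (f j : ℤ) < f ⟨i + d, by omega⟩ := h2
        simp only at h1
        omega
    have hlow : ∀ i : Fin N, m + ((N : ℤ) - 1 - i) ≤ f i := by
      intro i
      have hi := i.2
      have h1 := key i ⟨N - 1, by omega⟩ (by rw [Fin.le_def]; simp only; omega)
      have h2 := (f ⟨N - 1, by omega⟩).2.1
      simp only at h1
      omega
    have hhigh : ∀ i : Fin N, (f i : ℤ) + i < n := by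
      intro i
      have h1 := key ⟨0, by have := i.2; omega⟩ i (by rw [Fin.le_def]; simp)
      have h2 := (f ⟨0, by have := i.2; omega⟩).2.2
      simp only at h1
      omega
    refine ⟨fun i => ((f i : ℤ) - m - ((N : ℤ) - 1 - i)).toNat, ?_, ?_⟩
    · rw [mem_boxPartitions]
      refine ⟨fun i => ?_, fun i j hij => ?_⟩
      · have := hhigh i
        have := hlow i
        omega
      · have := key i j hij
        simp only
        omega
    · funext i
      ext
      have := hlow i
      simp only
      omega
  · intro lam _
    rfl

/-- The Cauchy–Binet formula with the sum written over partitions. -/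
theorem cauchyBinet_boxPartitions {R : Type*} [CommRing R] {m n : ℤ} {N M : ℕ}
    (hn : n = m + N + M) (α β : Fin N → ℤ → R) :
    (Matrix.of fun i j => ∑ l : Idx m n, α i l * β j l).det =
      ∑ lam ∈ boxPartitions N M,
        (Matrix.of fun i j => α i (m + lam j + ((N : ℤ) - 1 - j))).det *
          (Matrix.of fun i j => β j (m + lam i + ((N : ℤ) - 1 - i))).det := by
  classical
  have h : (Matrix.of fun i j => ∑ l : Idx m n, α i l * β j l) =
      (Matrix.of fun i (l : Idx m n) => α i l) * (Matrix.of fun (l : Idx m n) j => β j l) := by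
    ext i j
    simp [Matrix.mul_apply]
  rw [h, cauchyBinet_strictAnti, ← sum_strictAnti_eq_sum_boxPartitions hn (fun f =>
        (Matrix.of fun i j => α i (f j)).det * (Matrix.of fun i j => β j (f i)).det)]
  exact Finset.sum_congr (Finset.filter_congr_decidable _ _ _) fun _ _ => rfl

/-- The Jacobi–Trudi determinant `det [f_{λ_i - μ_j + j - i}]` of a power series `f`. -/
def jacobiTrudi {N : ℕ} {R : Type*} [CommRing R] (lam mu : Fin N → ℕ) (f : R⟦X⟧) : R :=
  (Matrix.of fun i j : Fin N => intCoeff f ((lam i : ℤ) - (mu j : ℤ) + (j : ℤ) - (i : ℤ))).det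

theorem skewSchur_eq_jacobiTrudi {N p : ℕ} (lam mu : Fin N → ℕ) (z : Fin p → ℂ) :
    skewSchur lam mu z = jacobiTrudi lam mu (completeSeries z) := by
  simp only [skewSchur, jacobiTrudi, completeSymm_eq_intCoeff]

theorem jacobiTrudi_mul {N M : ℕ} {R : Type*} [CommRing R] {lam mu : Fin N → ℕ}
    (hlam : lam ∈ boxPartitions N M) (hmu : mu ∈ boxPartitions N M) (f g : R⟦X⟧) :
    jacobiTrudi lam mu (f * g) =
      ∑ nu ∈ boxPartitions N M, jacobiTrudi lam nu f * jacobiTrudi nu mu g := by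
  have hlam' := (mem_boxPartitions.1 hlam).1
  have hmu' := (mem_boxPartitions.1 hmu).1
  let b : (nu : Fin N → ℕ) → Fin N → ℤ := fun nu i => nu i + ((N : ℤ) - 1 - i)
  have hcb := cauchyBinet_boxPartitions (m := 0) (n := 0 + N + M) (N := N) (M := M) rfl
    (fun i l => intCoeff f (b lam i - l)) (fun j l => intCoeff g (l - b mu j))
  have hidx : ∀ nu : Fin N → ℕ, (∀ i, nu i ≤ M) → ∀ i : Fin N,
      b nu i ∈ Set.Ico (0 : ℤ) (0 + N + M) := by
    intro nu hnu i
    have := hnu i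
    have := i.2
    simp only [b, Set.mem_Ico]
    omega
  have hprod : ∀ i j, ∑ l : Idx 0 (0 + N + M), intCoeff f (b lam i - l) *
      intCoeff g (l - b mu j) = intCoeff (f * g) (b lam i - b mu j) := by
    intro i j
    have := congrFun (congrFun (map_mul (toeplitz 0 (0 + N + M) R) f g)
      ⟨b lam i, hidx lam hlam' i⟩) ⟨b mu j, hidx mu hmu' j⟩
    rw [Matrix.mul_apply] at this
    simp only [toeplitz_apply] at this
    exact this.symm
  simp only [hprod] at hcb
  have harg : ∀ (nu ka : Fin N → ℕ) (i j : Fin N),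
      b nu i - b ka j = (nu i : ℤ) - ka j + j - i := by
    intro nu ka i j
    simp only [b]
    ring
  simp only [jacobiTrudi, ← harg]
  rw [hcb]
  refine Finset.sum_congr rfl fun nu _ => ?_
  simp only [b, zero_add]

/-- `lam / mu` is a horizontal strip. -/
def Interlaces {N : ℕ} (lam mu : Fin N → ℕ) : Prop :=
  (∀ i, mu i ≤ lam i) ∧ ∀ i j, i < j → lam j ≤ mu i

/-- A minor of the Toeplitz matrix of `(1 - z t)⁻¹`, by induction on its size. If `b 0 ≤ a k` for
some `k > 0`, the rows `0` and `k` are proportional; otherwise at most the first entry of the first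
column is nonzero. -/
theorem det_geometric {N : ℕ} (a b : Fin N → ℤ) (ha : Antitone a) (hb : Antitone b) (z : ℂ) :
    ((∀ i, b i ≤ a i) ∧ (∀ i j, i < j → a j < b i) →
      (Matrix.of fun i j => if 0 ≤ a i - b j then z ^ (a i - b j).toNat else 0).det =
        ∏ i, z ^ (a i - b i).toNat) ∧
    (¬ ((∀ i, b i ≤ a i) ∧ (∀ i j, i < j → a j < b i)) →
      (Matrix.of fun i j => if 0 ≤ a i - b j then z ^ (a i - b j).toNat else 0).det = 0) := by
  induction N with
  | zero => simp
  | succ N ih =>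
    have hsucc : Monotone (Fin.succ : Fin N → Fin (N + 1)) := Fin.strictMono_succ.monotone
    obtain ⟨ih1, ih2⟩ := ih (a ∘ Fin.succ) (b ∘ Fin.succ) (ha.comp_monotone hsucc)
      (hb.comp_monotone hsucc)
    by_cases hcol : ∀ i : Fin N, a i.succ < b 0
    · have hdet : (Matrix.of fun i j => if 0 ≤ a i - b j then z ^ (a i - b j).toNat else 0).det =
          (if 0 ≤ a 0 - b 0 then z ^ (a 0 - b 0).toNat else 0) *
          (Matrix.of fun i j => if 0 ≤ (a ∘ Fin.succ) i - (b ∘ Fin.succ) j then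
            z ^ ((a ∘ Fin.succ) i - (b ∘ Fin.succ) j).toNat else (0 : ℂ)).det := by
        rw [Matrix.det_succ_column_zero, Fin.sum_univ_succ]
        rw [Finset.sum_eq_zero, add_zero]
        · simp only [Fin.val_zero, pow_zero, one_mul, Matrix.of_apply]
          congr 1
        · intro i _
          rw [Matrix.of_apply, if_neg (by have := hcol i; omega)]
          simp
      rw [hdet]
      constructor
      · rintro ⟨h1, h2⟩
        rw [ih1 ⟨fun i => h1 _, fun i j hij => h2 _ _ (Fin.succ_lt_succ_iff.2 hij)⟩,
          Fin.prod_univ_succ, if_pos (by have := h1 0; omega)]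
        rfl
      · intro h
        by_cases h0 : b 0 ≤ a 0
        · rw [ih2, mul_zero]
          rintro ⟨h1, h2⟩
          refine h ⟨fun i => Fin.cases h0 (fun i => h1 i) i, fun i j hij => ?_⟩
          obtain ⟨j, rfl⟩ := Fin.exists_succ_eq.2 (Fin.ne_zero_of_lt hij)
          rcases Fin.eq_zero_or_eq_succ i with rfl | ⟨i, rfl⟩
          · exact hcol j
          · exact h2 i j (Fin.succ_lt_succ_iff.1 hij)
        · rw [if_neg (by omega), zero_mul]
    · push Not at hcol
      obtain ⟨k, hk⟩ := hcol
      constructor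
      · rintro ⟨-, h⟩
        exact absurd (h 0 k.succ (Fin.succ_pos k)) (by omega)
      · intro _
        have hk0 : a k.succ ≤ a 0 := ha (Fin.zero_le _)
        have hne : (0 : Fin (N + 1)) ≠ k.succ := (Fin.succ_ne_zero k).symm
        -- subtracting a multiple of the row `k + 1` clears the first row
        rw [← Matrix.det_updateRow_add_smul_self _ hne (-z ^ (a 0 - a k.succ).toNat)]
        refine Matrix.det_eq_zero_of_row_eq_zero 0 fun j => ?_
        have hj : b j ≤ b 0 := hb (Fin.zero_le _)
        simp only [Matrix.updateRow_self, Pi.add_apply, Pi.smul_apply, Matrix.of_apply, smul_eq_mul]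
        rw [if_pos (by omega), if_pos (by omega),
          show (a 0 - b j).toNat = (a 0 - a k.succ).toNat + (a k.succ - b j).toNat by omega,
          pow_add]
        ring

theorem skewSchur_single {N : ℕ} (lam mu : Fin N → ℕ) (hlam : Antitone lam) (hmu : Antitone mu)
    (z : ℂ) [Decidable (Interlaces lam mu)] :
    skewSchur lam mu (fun _ : Fin 1 => z) =
      if Interlaces lam mu then ∏ i, z ^ (lam i - mu i) else 0 := by
  have hsh : ∀ nu : Fin N → ℕ, Antitone nu → Antitone fun i => (nu i : ℤ) - i := by
    intro nu hnu i j hij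
    have := hnu hij
    rw [Fin.le_def] at hij
    simp only
    omega
  obtain ⟨h1, h2⟩ := det_geometric _ _ (hsh lam hlam) (hsh mu hmu) z
  have hdet : skewSchur lam mu (fun _ : Fin 1 => z) =
      (Matrix.of fun i j : Fin N => if 0 ≤ ((lam i : ℤ) - i) - ((mu j : ℤ) - j) then
        z ^ (((lam i : ℤ) - i) - ((mu j : ℤ) - j)).toNat else 0).det := by
    rw [skewSchur]
    congr 1
    ext i j
    rw [Matrix.of_apply, Matrix.of_apply, completeSymm_single,
      show (lam i : ℤ) - mu j + j - i = ((lam i : ℤ) - i) - ((mu j : ℤ) - j) by ring]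
  have hiff : Interlaces lam mu ↔ (∀ i : Fin N, (mu i : ℤ) - i ≤ (lam i : ℤ) - i) ∧
      (∀ i j : Fin N, i < j → (lam j : ℤ) - j < (mu i : ℤ) - i) := by
    refine and_congr (forall_congr' fun i => by omega) ⟨fun h i j hij => ?_, fun h i j hij => ?_⟩
    · have := h i j hij
      rw [Fin.lt_def] at hij
      omega
    · rw [Fin.lt_def] at hij
      have hj := j.2
      have h3 := h i ⟨i + 1, by omega⟩ (by rw [Fin.lt_def]; simp)
      have h4 : lam j ≤ lam ⟨i + 1, by omega⟩ := hlam (by rw [Fin.le_def]; simp only; omega)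
      simp only at h3
      omega
  rw [hdet]
  split_ifs with h
  · rw [h1 (hiff.1 h)]
    refine Finset.prod_congr rfl fun i _ => ?_
    congr 1
    omega
  · exact h2 fun h' => h (hiff.2 h')

theorem skewSchur_empty {N : ℕ} {lam mu : Fin N → ℕ} (hlam : Antitone lam) (hmu : Antitone mu)
    (z : Fin 0 → ℂ) : skewSchur lam mu z = if lam = mu then 1 else 0 := by
  classical
  -- having no variables is the same as having one variable equal to zero
  have h : completeSeries z = completeSeries (fun _ : Fin 1 => (0 : ℂ)) := by
    have := completeSeries_cons_eq_mul 0 z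
    have h2 := completeSeries_cons 0 z
    rw [map_zero, zero_mul, sub_zero, one_mul] at h2
    rw [completeSeries_zero, mul_one] at this
    rw [← h2, this]
  rw [skewSchur_eq_jacobiTrudi, h, ← skewSchur_eq_jacobiTrudi, skewSchur_single _ _ hlam hmu]
  by_cases heq : lam = mu
  · subst heq
    rw [if_pos ⟨fun _ => le_rfl, fun i j hij => hlam hij.le⟩, if_pos rfl]
    simp
  · rw [if_neg heq]
    split_ifs with hi
    · obtain ⟨i, hne⟩ := Function.ne_iff.1 heq
      refine Finset.prod_eq_zero (Finset.mem_univ i) (zero_pow ?_)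
      have := hi.1 i
      omega
    · rfl

/-- The branching rule: the first variable fills the outer strip `λ / ν`. -/
theorem skewSchur_cons {N M p : ℕ} {lam mu : Fin N → ℕ}
    (hlam : lam ∈ boxPartitions N M) (hmu : mu ∈ boxPartitions N M) (z₀ : ℂ) (z : Fin p → ℂ) :
    skewSchur lam mu (Fin.cons z₀ z : Fin (p + 1) → ℂ) = ∑ nu ∈ boxPartitions N M,
      skewSchur lam nu (fun _ : Fin 1 => z₀) * skewSchur nu mu z := by
  simp only [skewSchur_eq_jacobiTrudi]
  rw [completeSeries_cons_eq_mul, jacobiTrudi_mul hlam hmu]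

/-- The branching rule, with the first variable filling the inner strip `ν / μ`. -/
theorem skewSchur_cons' {N M p : ℕ} {lam mu : Fin N → ℕ}
    (hlam : lam ∈ boxPartitions N M) (hmu : mu ∈ boxPartitions N M) (z₀ : ℂ) (z : Fin p → ℂ) :
    skewSchur lam mu (Fin.cons z₀ z : Fin (p + 1) → ℂ) = ∑ nu ∈ boxPartitions N M,
      skewSchur lam nu z * skewSchur nu mu (fun _ : Fin 1 => z₀) := by
  simp only [skewSchur_eq_jacobiTrudi]
  rw [completeSeries_cons_eq_mul, mul_comm, jacobiTrudi_mul hlam hmu]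

/-- A skew Schur polynomial in `p` variables vanishes unless `μ ⊆ λ` and every column of `λ / μ`
has at most `p` boxes. -/
theorem le_of_skewSchur_ne_zero {N M p : ℕ} {lam mu : Fin N → ℕ}
    (hlam : lam ∈ boxPartitions N M) (hmu : mu ∈ boxPartitions N M) (z : Fin p → ℂ)
    (h : skewSchur lam mu z ≠ 0) :
    (∀ i, mu i ≤ lam i) ∧ ∀ i j : Fin N, (i : ℕ) + p ≤ j → lam j ≤ mu i := by
  classical
  have hl := (mem_boxPartitions.1 hlam).2
  induction p generalizing lam with
  | zero =>
    rw [skewSchur_empty hl (mem_boxPartitions.1 hmu).2] at h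
    obtain rfl : lam = mu := by
      by_contra hne
      exact h (if_neg hne)
    exact ⟨fun _ => le_rfl, fun i j hij => hl (by rw [Fin.le_def]; omega)⟩
  | succ p ih =>
    obtain ⟨z₀, z, rfl⟩ : ∃ z₀ z', z = Fin.cons z₀ z' :=
      ⟨z 0, Fin.tail z, (Fin.cons_self_tail z).symm⟩
    rw [skewSchur_cons hlam hmu] at h
    obtain ⟨nu, hnu, hne⟩ := Finset.exists_ne_zero_of_sum_ne_zero h
    have hn := (mem_boxPartitions.1 hnu).2
    have hint : Interlaces lam nu := by
      by_contra hni
      exact hne (by rw [skewSchur_single _ _ hl hn, if_neg hni, zero_mul])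
    obtain ⟨h1, h2⟩ := ih hnu z (right_ne_zero_of_mul hne) hn
    refine ⟨fun i => (h1 i).trans (hint.1 i), fun i j hij => ?_⟩
    have hj := j.2
    exact (hint.2 ⟨j - 1, by omega⟩ j (by rw [Fin.lt_def]; simp only; omega)).trans
      (h2 i _ (by simp only; omega))

theorem skewSchur_cons_zero {N p : ℕ} (lam mu : Fin N → ℕ) (z : Fin p → ℂ) :
    skewSchur lam mu (Fin.cons 0 z : Fin (p + 1) → ℂ) = skewSchur lam mu z := by
  simp only [skewSchur, completeSymm_cons_zero]

theorem continuous_skewSchur {N p : ℕ} (lam mu : Fin N → ℕ) :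
    Continuous fun z : Fin p → ℂ => skewSchur lam mu z := by
  unfold skewSchur
  exact Continuous.matrix_det (continuous_matrix fun i j => continuous_completeSymm _)

end Branching

/-! ### Exponentials of the shift matrix -/

section TimeExp

open PowerSeries

variable {R S : Type*} [CommRing R] [CommRing S] {D : ℕ}

/-- The series `∑ⱼ xⱼ tʲ`. -/
def timeSum (x : Fin D → R) : R⟦X⟧ := ∑ j, x j • X ^ ((j : ℕ) + 1)

theorem X_dvd_timeSum (x : Fin D → R) : X ∣ timeSum x :=
  Finset.dvd_sum fun j _ => by
    rw [pow_succ, smul_eq_C_mul, ← mul_assoc]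
    exact dvd_mul_left _ _

theorem coeff_timeSum_succ (x : Fin D → R) (i : Fin D) :
    coeff ((i : ℕ) + 1) (timeSum x) = x i := by
  rw [timeSum, map_sum, Finset.sum_eq_single i]
  · simp [smul_eq_C_mul]
  · intro j _ hj
    rw [smul_eq_C_mul, coeff_C_mul, coeff_X_pow, if_neg, mul_zero]
    intro h
    exact hj (Fin.ext (by omega))
  · simp

variable [Algebra ℂ R] [Algebra ℂ S]

/-- The exponential of `∑ⱼ xⱼ tʲ`, cut off after the power that contributes to the coefficients of
degree at most the number of times. -/
def timeExp (x : Fin D → R) : R⟦X⟧ :=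
  ∑ a ∈ Finset.range (D + 1), algebraMap ℂ R (a.factorial : ℂ)⁻¹ • timeSum x ^ a

theorem map_timeExp (f : R →ₐ[ℂ] S) (x : Fin D → R) :
    PowerSeries.map (f : R →+* S) (timeExp x) = timeExp fun j => f (x j) := by
  simp only [timeExp, timeSum, map_sum, smul_eq_C_mul, map_mul, map_pow, map_C, map_X,
    RingHom.coe_coe, AlgHom.commutes]

theorem map_intCoeff_timeExp (f : R →ₐ[ℂ] S) (x : Fin D → R) (p : ℤ) :
    f (intCoeff (timeExp x) p) = intCoeff (timeExp fun j => f (x j)) p := by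
  rw [← map_timeExp, intCoeff, intCoeff]
  split_ifs <;> simp

theorem derivative_timeExp (x : Fin D → ℂ) :
    derivative ℂ (timeExp x) = derivative ℂ (timeSum x) *
      (timeExp x - ((D.factorial : ℂ)⁻¹ • timeSum x ^ D)) := by
  have h : timeExp x - ((D.factorial : ℂ)⁻¹ • timeSum x ^ D) =
      ∑ a ∈ Finset.range D, (a.factorial : ℂ)⁻¹ • timeSum x ^ a := by
    rw [timeExp, Finset.sum_range_succ]
    simp only [Algebra.algebraMap_self, RingHom.id_apply, add_sub_cancel_right]
  rw [h, timeExp, map_sum, Finset.sum_range_succ']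
  simp only [Nat.factorial_zero, Nat.cast_one, pow_zero, Algebra.algebraMap_self, RingHom.id_apply,
    Derivation.map_smul, Derivation.map_one_eq_zero, smul_zero, add_zero, Finset.mul_sum]
  refine Finset.sum_congr rfl fun a _ => ?_
  rw [Derivation.leibniz_pow, Nat.add_sub_cancel, Nat.factorial_succ]
  have h : ((a : ℂ) + 1) ≠ 0 := by exact_mod_cast Nat.succ_ne_zero a
  have h2 : (((a + 1) * a.factorial : ℕ) : ℂ)⁻¹ * ((a + 1 : ℕ) : ℂ) = (a.factorial : ℂ)⁻¹ := by
    have h3 : (a.factorial : ℂ) ≠ 0 := by exact_mod_cast a.factorial_ne_zero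
    push_cast
    field_simp
  rw [← h2]
  simp only [smul_eq_C_mul, smul_eq_mul, nsmul_eq_mul, map_mul, map_natCast]
  ring

/-- At power sums, the coefficients of `exp (∑ⱼ pⱼ tʲ / j)` are the complete homogeneous symmetric
polynomials: both satisfy Newton's recurrence. -/
theorem coeff_timeExp_powerTimes {p : ℕ} (z : Fin p → ℂ) (k : ℕ) (hk : k ≤ D) :
    coeff k (timeExp (powerTimes D z)) = coeff k (completeSeries z) := by
  induction k using Nat.strong_induction_on with
  | _ k ih =>
  rcases k with _ | k
  · have h0 : constantCoeff (timeSum (powerTimes D z)) = 0 := by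
      exact X_dvd_iff.1 (X_dvd_timeSum (R := ℂ) _)
    rw [timeExp, map_sum, Finset.sum_range_succ']
    simp [h0, completeSeries, smul_eq_C_mul]
  · have hF := congrArg (coeff k) (derivative_timeExp (powerTimes D z))
    have hH := congrArg (coeff k) (derivative_completeSeries z)
    -- the correction from cutting off the exponential series starts in degree `D`
    have hdvd : (X : ℂ⟦X⟧) ^ D ∣ derivative ℂ (timeSum (powerTimes D z)) *
        ((D.factorial : ℂ)⁻¹ • timeSum (powerTimes D z) ^ D) := by
      rw [smul_eq_C_mul]
      exact ((pow_dvd_pow_of_dvd (X_dvd_timeSum (R := ℂ) _) D).mul_left _).mul_left _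
    rw [mul_sub, map_sub, X_pow_dvd_iff.1 hdvd k (by omega), sub_zero, mul_comm, coeff_mul,
      coeff_derivative] at hF
    rw [coeff_mul, coeff_derivative] at hH
    have hk0 : ((k : ℂ) + 1) ≠ 0 := by exact_mod_cast Nat.succ_ne_zero k
    apply mul_right_cancel₀ hk0
    rw [hF, hH]
    refine Finset.sum_congr rfl fun a ha => ?_
    rw [Finset.HasAntidiagonal.mem_antidiagonal] at ha
    rw [ih a.1 (by omega) (by omega), coeff_derivative, coeff_mk]
    have := coeff_timeSum_succ (R := ℂ) (powerTimes D z) ⟨a.2, by omega⟩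
    simp only at this
    rw [this, powerTimes]
    have h1 : ((a.2 : ℂ) + 1) ≠ 0 := by exact_mod_cast Nat.succ_ne_zero a.2
    push_cast
    field_simp

theorem intCoeff_timeExp_powerTimes {p : ℕ} (z : Fin p → ℂ) (k : ℤ) (hk : k ≤ D) :
    intCoeff (timeExp (powerTimes D z)) k = completeSymm z k := by
  rw [completeSymm_eq_intCoeff]
  rcases lt_or_ge k 0 with h | h
  · rw [intCoeff_of_neg _ h, intCoeff_of_neg _ h]
  · lift k to ℕ using h
    rw [intCoeff_natCast, intCoeff_natCast, coeff_timeExp_powerTimes z k (by exact_mod_cast hk)]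

theorem timeExp_zero : timeExp (0 : Fin D → R) = 1 := by
  have h : timeSum (0 : Fin D → R) = 0 := by simp [timeSum]
  rw [timeExp, Finset.sum_range_succ']
  simp [h]

end TimeExp

section Exponential

open PowerSeries

variable {m n : ℤ} {K : Type} [Field K]

theorem shift_transpose_eq_toeplitz : (shift m n K).transpose = toeplitz m n K X := by
  ext a b
  rw [Matrix.transpose_apply, shift, Matrix.of_apply, toeplitz_apply]
  rcases lt_or_ge ((a : ℤ) - b) 0 with h | h
  · rw [intCoeff_of_neg _ h, if_neg (by omega)]
  · obtain ⟨d, hd⟩ := Int.eq_ofNat_of_zero_le h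
    rw [hd, intCoeff_natCast, coeff_X]
    congr 1
    apply propext
    omega

theorem sum_smul_shift_transpose (x : Fin (numTimes m n) → K) :
    ∑ j, x j • (shift m n K).transpose ^ ((j : ℕ) + 1) = toeplitz m n K (timeSum x) := by
  rw [timeSum, map_sum]
  refine Finset.sum_congr rfl fun j _ => ?_
  rw [map_smul, map_pow, shift_transpose_eq_toeplitz]

theorem sum_smul_shift (x : Fin (numTimes m n) → K) :
    ∑ j, x j • (shift m n K) ^ ((j : ℕ) + 1) = (toeplitz m n K (timeSum x)).transpose := by
  rw [← sum_smul_shift_transpose, Matrix.transpose_sum]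
  refine Finset.sum_congr rfl fun j _ => ?_
  rw [Matrix.transpose_smul, Matrix.transpose_pow, Matrix.transpose_transpose]

theorem toeplitz_timeSum_pow (x : Fin (numTimes m n) → K) :
    toeplitz m n K (timeSum x) ^ (numTimes m n + 1) = 0 := by
  rw [← map_pow]
  ext a b
  rw [toeplitz_apply, Matrix.zero_apply]
  rcases lt_or_ge ((a : ℤ) - b) 0 with h | h
  · exact intCoeff_of_neg _ h
  · obtain ⟨d, hd⟩ := Int.eq_ofNat_of_zero_le h
    have ha := a.2.2
    have hb := b.2.1
    rw [hd, intCoeff_natCast]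
    refine X_pow_dvd_iff.1 (pow_dvd_pow_of_dvd (X_dvd_timeSum x) _) d ?_
    simp only [numTimes]
    omega

variable [CharZero K]

theorem expY_mul_expY_neg (y : Fin (numTimes m n) → K) : expY y * expY (-y) = 1 := by
  have h : IsNilpotent (∑ j, y j • (shift m n K).transpose ^ ((j : ℕ) + 1)) :=
    ⟨_, by rw [sum_smul_shift_transpose]; exact toeplitz_timeSum_pow y⟩
  have hneg : ∑ j, (-y) j • (shift m n K).transpose ^ ((j : ℕ) + 1) =
      -∑ j, y j • (shift m n K).transpose ^ ((j : ℕ) + 1) := by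
    rw [← Finset.sum_neg_distrib]
    exact Finset.sum_congr rfl fun j _ => neg_smul _ _
  rw [expY, expY, hneg, IsNilpotent.exp_mul_exp_neg_self h]

variable [Algebra ℂ K]

theorem inv_factorial_smul (a : ℕ) (A : Matrix (Idx m n) (Idx m n) K) :
    ((a.factorial : ℚ)⁻¹ • A) = algebraMap ℂ K (a.factorial : ℂ)⁻¹ • A := by
  ext i j
  rw [Matrix.smul_apply, Matrix.smul_apply, Rat.smul_def, smul_eq_mul]
  simp

theorem expY_eq_toeplitz (y : Fin (numTimes m n) → K) :
    expY y = toeplitz m n K (timeExp y) := by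
  rw [expY, sum_smul_shift_transpose, IsNilpotent.exp_eq_sum (toeplitz_timeSum_pow y), timeExp,
    map_sum]
  refine Finset.sum_congr rfl fun a _ => ?_
  rw [inv_factorial_smul, map_smul, map_pow]

theorem expX_eq_toeplitz (x : Fin (numTimes m n) → K) :
    expX x = (toeplitz m n K (timeExp x)).transpose := by
  have h : (toeplitz m n K (timeSum x)).transpose ^ (numTimes m n + 1) = 0 := by
    rw [← Matrix.transpose_pow, toeplitz_timeSum_pow, Matrix.transpose_zero]
  rw [expX, sum_smul_shift, IsNilpotent.exp_eq_sum h, timeExp, map_sum, Matrix.transpose_sum]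
  refine Finset.sum_congr rfl fun a _ => ?_
  rw [inv_factorial_smul, map_smul, map_pow, Matrix.transpose_smul, Matrix.transpose_pow]

end Exponential

section TimeMatrix

variable {m n : ℤ} {R S : Type*} [CommRing R] [CommRing S] [Algebra ℂ R] [Algebra ℂ S] {D : ℕ}

/-- The matrix `exp (∑ x_k Λ^k) exp (∑ y_k (Λᵀ)^k)` over any `ℂ`-algebra. -/
def timeMatrix (m n : ℤ) (x y : Fin D → R) : Matrix (Idx m n) (Idx m n) R :=
  Matrix.of fun i j => ∑ l : Idx m n,
    intCoeff (timeExp x) ((l : ℤ) - i) * intCoeff (timeExp y) ((l : ℤ) - j)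

theorem map_timeMatrix (f : R →ₐ[ℂ] S) (x y : Fin D → R) (i j : Idx m n) :
    f (timeMatrix m n x y i j) = timeMatrix m n (fun j => f (x j)) (fun j => f (y j)) i j := by
  simp only [timeMatrix, Matrix.of_apply, map_sum, map_mul, map_intCoeff_timeExp]

theorem timeMatrix_zero : timeMatrix m n (0 : Fin D → R) (0 : Fin D → R) = 1 := by
  ext i j
  rw [timeMatrix, Matrix.of_apply, Finset.sum_eq_single i]
  · rw [timeExp_zero, intCoeff_one, intCoeff_one, Matrix.one_apply, if_pos (sub_self _), one_mul]
    simp only [sub_eq_zero, Subtype.ext_iff]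
  · intro l _ hl
    rw [timeExp_zero, intCoeff_one, if_neg, zero_mul]
    rw [sub_eq_zero]
    exact fun h => hl (Subtype.ext h)
  · simp

theorem evolved_one {K : Type} [Field K] [CharZero K] [Algebra ℂ K]
    (x y : Fin (numTimes m n) → K) : evolved 1 x y = timeMatrix m n x (-y) := by
  ext i j
  rw [evolved, mul_one, expX_eq_toeplitz, expY_eq_toeplitz, Matrix.mul_apply]
  rfl

end TimeMatrix

/-! ### Lower-upper factorization -/

section LowerUpper

variable {ι K : Type*} [Fintype ι] [LinearOrder ι] [Field K]

/-- The leading principal block of `G` strictly before `s`. -/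
abbrev leadingBlock (G : Matrix ι ι K) (s : ι) : Matrix {i // i < s} {i // i < s} K :=
  G.submatrix Subtype.val Subtype.val

theorem unitLower_mul_apply {W : Matrix ι ι K} (h1 : ∀ i, W i i = 1) (h0 : ∀ i j, i < j → W i j = 0)
    (G : Matrix ι ι K) (s t : ι) :
    (W * G) s t = ∑ i : {i // i < s}, W s i * G i t + G s t := by
  rw [Matrix.mul_apply, ← Finset.sum_subtype (p := fun i => i < s)
    (Finset.univ.filter fun i => i < s) (by simp) (fun i => W s i * G i t),
    ← Finset.sum_filter_add_sum_filter_not Finset.univ (fun i => i < s)]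
  congr 1
  rw [Finset.sum_eq_single s]
  · rw [h1, one_mul]
  · intro i hi hne
    rw [Finset.mem_filter] at hi
    rw [h0 s i (lt_of_le_of_ne (not_lt.1 hi.2) hne.symm), zero_mul]
  · simp

/-- A matrix with nonvanishing leading principal minors has exactly one factorization
`W₁⁻¹ W₂` with `W₁` unit lower and `W₂` upper triangular: the part of the `s`-th row of `W₁` before
the diagonal solves a linear system with matrix `leadingBlock G s`. -/
theorem existsUnique_lowerUpper (G : Matrix ι ι K) (hG : ∀ s, (leadingBlock G s).det ≠ 0) :
    ∃! W : Matrix ι ι K × Matrix ι ι K, (∀ i, W.1 i i = 1) ∧ (∀ i j, i < j → W.1 i j = 0) ∧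
      (∀ i j, j < i → W.2 i j = 0) ∧ W.2 = W.1 * G := by
  have hunit : ∀ s, IsUnit (leadingBlock G s).det := fun s => (hG s).isUnit
  let w : (s : ι) → {i // i < s} → K := fun s =>
    Matrix.vecMul (fun j : {i // i < s} => -G s j) (leadingBlock G s)⁻¹
  let W : Matrix ι ι K := Matrix.of fun s j =>
    if h : j < s then w s ⟨j, h⟩ else if j = s then 1 else 0
  have hW1 : ∀ i, W i i = 1 := fun i => by simp [W]
  have hW0 : ∀ i j, i < j → W i j = 0 := fun i j hij => by
    simp [W, hij.not_gt, hij.ne']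
  refine ⟨(W, W * G), ⟨hW1, hW0, fun s j hj => ?_, rfl⟩, ?_⟩
  · simp only
    rw [unitLower_mul_apply hW1 hW0]
    have h : Matrix.vecMul (w s) (leadingBlock G s) = fun j : {i // i < s} => -G s j := by
      rw [Matrix.vecMul_vecMul, Matrix.nonsing_inv_mul _ (hunit s), Matrix.vecMul_one]
    have h2 := congrFun h ⟨j, hj⟩
    rw [Matrix.vecMul, dotProduct] at h2
    have h3 : ∑ i : {i // i < s}, W s i * G i j = -G s j := by
      rw [← h2]
      refine Finset.sum_congr rfl fun i _ => ?_
      simp only [W, Matrix.of_apply, dif_pos i.2, Matrix.submatrix_apply]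
    rw [h3, neg_add_cancel]
  · rintro ⟨V, U⟩ ⟨hV1, hV0, hU, hVU⟩
    simp only at hV1 hV0 hU hVU
    have hVW : V = W := by
      ext s j
      rcases lt_trichotomy j s with hj | rfl | hj
      · have h : Matrix.vecMul (fun i : {i // i < s} => V s i) (leadingBlock G s) =
            fun j : {i // i < s} => -G s j := by
          funext k
          have := hU s k k.2
          rw [hVU, unitLower_mul_apply hV1 hV0] at this
          exact eq_neg_of_add_eq_zero_left this
        have h2 : (fun i : {i // i < s} => V s i) = w s := by
          simp only [w]
          rw [← h, Matrix.vecMul_vecMul, Matrix.mul_nonsing_inv _ (hunit s), Matrix.vecMul_one]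
        rw [show V s j = w s ⟨j, hj⟩ from congrFun h2 ⟨j, hj⟩]
        simp [W, hj]
      · rw [hV1, hW1]
      · rw [hV0 _ _ hj, hW0 _ _ hj]
    rw [hVU, hVW]

/-- The upper triangular factor as a ratio of minors: adding to the last row of the bordered block
the multiples of the other rows prescribed by `V` clears it except for its last entry. -/
theorem det_leadingBlock_mul_upper {G V U : Matrix ι ι K} (hV1 : ∀ i, V i i = 1)
    (hV0 : ∀ i j, i < j → V i j = 0) (hU : ∀ i j, j < i → U i j = 0) (hVU : U = V * G) (s t : ι) :
    (leadingBlock G s).det * U s t =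
      (G.submatrix (Sum.elim Subtype.val fun _ : Unit => s : {i // i < s} ⊕ Unit → ι)
        (Sum.elim Subtype.val fun _ : Unit => t)).det := by
  have hblock : G.submatrix (Sum.elim Subtype.val fun _ : Unit => s : {i // i < s} ⊕ Unit → ι)
      (Sum.elim Subtype.val fun _ : Unit => t) =
      Matrix.fromBlocks (leadingBlock G s) (Matrix.of fun (i : {i // i < s}) (_ : Unit) => G i t)
        (Matrix.of fun (_ : Unit) (j : {i // i < s}) => G s j)
        (Matrix.of fun (_ : Unit) (_ : Unit) => G s t) := by
    ext (i | i) (j | j) <;> rfl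
  let w : Matrix Unit {i // i < s} K := Matrix.of fun _ i => V s i
  have hmul : Matrix.fromBlocks 1 0 w 1 * Matrix.fromBlocks (leadingBlock G s)
        (Matrix.of fun (i : {i // i < s}) (_ : Unit) => G i t)
        (Matrix.of fun (_ : Unit) (j : {i // i < s}) => G s j)
        (Matrix.of fun (_ : Unit) (_ : Unit) => G s t) =
      Matrix.fromBlocks (leadingBlock G s) (Matrix.of fun (i : {i // i < s}) (_ : Unit) => G i t)
        0 (Matrix.of fun (_ : Unit) (_ : Unit) => U s t) := by
    rw [Matrix.fromBlocks_multiply]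
    simp only [one_mul, Matrix.one_mul, Matrix.zero_mul, add_zero]
    congr 1
    · ext i j
      have := hU s j j.2
      rw [hVU, unitLower_mul_apply hV1 hV0] at this
      rw [Matrix.add_apply, Matrix.mul_apply, Matrix.zero_apply, ← this]
      rfl
    · ext i j
      rw [hVU, Matrix.add_apply, Matrix.mul_apply, Matrix.of_apply, Matrix.of_apply,
        unitLower_mul_apply hV1 hV0]
      rfl
  have hdet := congrArg Matrix.det hmul
  rw [Matrix.det_mul, Matrix.det_fromBlocks_zero₁₂, Matrix.det_fromBlocks_zero₂₁] at hdet
  rw [hblock]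
  simpa using hdet.symm

end LowerUpper

/-! ### Wave matrices -/

section WaveMatrices

variable {m n : ℤ}

/-- The matrix `exp (∑ x_k Λ^k) exp (-∑ y_k (Λᵀ)^k)` with polynomial entries. -/
def polyMatrix (m n : ℤ) : Matrix (Idx m n) (Idx m n) (TimePoly m n) :=
  timeMatrix m n (fun j => MvPolynomial.X (Sum.inl j)) (fun j => -MvPolynomial.X (Sum.inr j))

theorem evolved_eq_map_polyMatrix :
    evolved 1 (xVar m n) (yVar m n) =
      (polyMatrix m n).map (algebraMap (TimePoly m n) (TimeField m n)) := by
  rw [evolved_one]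
  ext i j
  have := map_timeMatrix (IsScalarTower.toAlgHom ℂ (TimePoly m n) (TimeField m n))
    (fun j => MvPolynomial.X (Sum.inl j)) (fun j => -MvPolynomial.X (Sum.inr j)) i j
  rw [IsScalarTower.coe_toAlgHom'] at this
  rw [Matrix.map_apply, polyMatrix, this]
  congr 1
  funext j
  simp [yVar]

/-- The leading principal minors are nonzero, since they are equal to one at time zero. -/
theorem det_leadingBlock_evolved_ne_zero (s : Idx m n) :
    (leadingBlock (evolved 1 (xVar m n) (yVar m n)) s).det ≠ 0 := by
  rw [evolved_eq_map_polyMatrix]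
  have h : leadingBlock ((polyMatrix m n).map (algebraMap (TimePoly m n) (TimeField m n))) s =
      ((polyMatrix m n).submatrix Subtype.val Subtype.val).map
        (algebraMap (TimePoly m n) (TimeField m n)) := rfl
  rw [h, ← RingHom.mapMatrix_apply, ← RingHom.map_det, Ne,
    FaithfulSMul.algebraMap_eq_zero_iff (TimePoly m n) (TimeField m n)]
  intro h0
  have h1 := congrArg (MvPolynomial.aeval (fun _ => (0 : ℂ))) h0
  rw [map_zero, AlgHom.map_det] at h1
  have h2 : (MvPolynomial.aeval (fun _ => (0 : ℂ))).mapMatrix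
      ((polyMatrix m n).submatrix Subtype.val Subtype.val : Matrix {i // i < s} {i // i < s} _) =
      (1 : Matrix {i // i < s} {i // i < s} ℂ) := by
    have h3 : (polyMatrix m n).map (MvPolynomial.aeval (fun _ => (0 : ℂ))) = 1 := by
      ext i j
      rw [Matrix.map_apply, polyMatrix, map_timeMatrix]
      rw [← timeMatrix_zero (D := numTimes m n)]
      congr 1 <;>
      · funext j
        simp
    have h4 := congrArg (fun A => A.submatrix (Subtype.val : {i // i < s} → _)
      (Subtype.val : {i // i < s} → _)) h3
    simp only [Matrix.submatrix_one _ Subtype.val_injective] at h4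
    exact h4
  rw [h2, Matrix.det_one] at h1
  exact one_ne_zero h1

theorem isWavePair_iff (x y : Fin (numTimes m n) → TimeField m n)
    (V U : Matrix (Idx m n) (Idx m n) (TimeField m n)) :
    IsWavePair 1 x y V U ↔ (∀ i, V i i = 1) ∧ (∀ i j, i < j → V i j = 0) ∧
      (∀ i j, j < i → U i j = 0) ∧ U = V * evolved 1 x y := by
  have h1 : expY y * expY (-y) = 1 := expY_mul_expY_neg y
  have h2 : expY (-y) * expY y = 1 := by
    have := expY_mul_expY_neg (-y)
    rwa [neg_neg] at this
  constructor
  · rintro ⟨ha, hb, hc, hd⟩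
    refine ⟨ha, hb, hc, ?_⟩
    rw [mul_one] at hd
    rw [evolved, mul_one, ← mul_assoc, ← hd, mul_assoc, h1, mul_one]
  · rintro ⟨ha, hb, hc, hd⟩
    refine ⟨ha, hb, hc, ?_⟩
    rw [hd, evolved, mul_one, mul_one, mul_assoc, mul_assoc, h2, mul_one]

theorem existsUnique_isWavePair (m n : ℤ) :
    ∃! W : Matrix (Idx m n) (Idx m n) (TimeField m n) ×
        Matrix (Idx m n) (Idx m n) (TimeField m n),
      IsWavePair 1 (xVar m n) (yVar m n) W.1 W.2 := by
  simp only [isWavePair_iff]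
  exact existsUnique_lowerUpper _ det_leadingBlock_evolved_ne_zero

/-- The index `m + λ i + (r - i)` attached to the `i`-th part of a partition `λ` with `r + 1` parts,
so that partitions correspond to strictly decreasing sequences. -/
def partIdx {r M : ℕ} (hn : n = m + ((r : ℤ) + 1) + M) (lam : Fin (r + 1) → ℕ)
    (hlam : ∀ i, lam i ≤ M) (i : Fin (r + 1)) : Idx m n :=
  ⟨m + lam i + ((r : ℤ) - i), by
    have := hlam i
    have := i.2
    exact Set.mem_Ico.2 ⟨by omega, by omega⟩⟩

theorem oneRow_le {r M : ℕ} (k : Fin (M + 1)) (i : Fin (r + 1)) : oneRow r k i ≤ M := by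
  have := k.2
  refine Fin.cases ?_ (fun i => ?_) i <;> simp [oneRow]
  omega

/-- The polynomial `τ(s) ŵ_k^{(0)}(s)` at `s = m + r`: the minor with rows `m, …, m + r` and columns
`m, …, m + r - 1, m + r + k`, both in decreasing order. -/
def boundaryPoly {r M : ℕ} (hn : n = m + ((r : ℤ) + 1) + M) (k : Fin (M + 1)) : TimePoly m n :=
  ((polyMatrix m n).submatrix (partIdx hn (fun _ => 0) fun _ => Nat.zero_le _)
    (partIdx hn (oneRow r k) (oneRow_le k))).det

/-- The rows before `s = m + r` in decreasing order, preceded by the bordering row. -/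
def borderEquiv {r M : ℕ} (hn : n = m + ((r : ℤ) + 1) + M) (s : Idx m n) (hs : (s : ℤ) = m + r) :
    Fin (r + 1) ≃ {i : Idx m n // i < s} ⊕ Unit where
  toFun := Fin.cases (Sum.inr ()) fun i =>
    Sum.inl ⟨⟨m + ((r : ℤ) - 1 - i), by
      have := i.2
      exact Set.mem_Ico.2 ⟨by omega, by omega⟩⟩, by
      have := i.2
      change m + ((r : ℤ) - 1 - i) < (s : ℤ)
      omega⟩
  invFun := Sum.elim (fun i => ⟨r - ((i : ℤ) - m).toNat, by omega⟩) fun _ => 0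
  left_inv i := by
    refine Fin.cases rfl (fun i => ?_) i
    ext
    have := i.2
    simp only [Fin.cases_succ, Sum.elim_inl, Fin.val_succ]
    omega
  right_inv i := by
    rcases i with ⟨⟨i, hi⟩, hlt⟩ | i
    · have hlt' : i < (s : ℤ) := hlt
      have hi' := hi.1
      have h : (⟨r - (i - m).toNat, by omega⟩ : Fin (r + 1)) =
          Fin.succ ⟨r - (i - m).toNat - 1, by omega⟩ := by
        ext
        simp only [Fin.val_succ]
        omega
      simp only [Sum.elim_inl, h, Fin.cases_succ]
      congr 2
      ext
      simp only
      omega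
    · rfl

theorem algebraMap_boundaryPoly {r M : ℕ} (hn : n = m + ((r : ℤ) + 1) + M) (k : Fin (M + 1))
    {V U : Matrix (Idx m n) (Idx m n) (TimeField m n)}
    (h : IsWavePair 1 (xVar m n) (yVar m n) V U) (s t : Idx m n) (hs : (s : ℤ) = m + r)
    (ht : (t : ℤ) = m + r + (k : ℕ)) :
    algebraMap (TimePoly m n) (TimeField m n) (boundaryPoly hn k) =
      tau 1 (xVar m n) (yVar m n) (m + r) * U s t := by
  obtain ⟨h1, h0, hU, hVU⟩ := (isWavePair_iff _ _ _ _).1 h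
  have htau : tau 1 (xVar m n) (yVar m n) (m + r) =
      (leadingBlock (evolved 1 (xVar m n) (yVar m n)) s).det := by
    rw [← hs]
    rfl
  rw [htau]
  refine Eq.trans ?_ (det_leadingBlock_mul_upper h1 h0 hU hVU s t).symm
  rw [evolved_eq_map_polyMatrix, boundaryPoly,
    RingHom.map_det]
  refine Eq.trans ?_ (Matrix.det_submatrix_equiv_self (borderEquiv hn s hs) _)
  congr 1
  ext i j
  simp only [RingHom.mapMatrix_apply, Matrix.map_apply, Matrix.submatrix_apply]
  congr 2
  · refine Fin.cases ?_ (fun i => ?_) i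
    · ext
      simp [partIdx, borderEquiv, hs]
    · ext
      simp only [partIdx, borderEquiv, Equiv.coe_fn_mk, Fin.cases_succ, Sum.elim_inl, Fin.val_succ]
      push_cast
      ring
  · refine Fin.cases ?_ (fun i => ?_) j
    · ext
      simp only [partIdx, borderEquiv, Equiv.coe_fn_mk, Fin.cases_zero, Sum.elim_inr, oneRow,
        Fin.cons_zero, ht, Fin.val_zero]
      push_cast
      ring
    · ext
      simp only [partIdx, borderEquiv, Equiv.coe_fn_mk, Fin.cases_succ, Sum.elim_inl, Fin.val_succ,
        oneRow, Fin.cons_succ]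
      push_cast
      ring

theorem oneRow_mem_boxPartitions {r M : ℕ} (k : Fin (M + 1)) :
    oneRow r k ∈ boxPartitions (r + 1) M := by
  rw [mem_boxPartitions]
  refine ⟨oneRow_le k, fun i j hij => ?_⟩
  rcases Fin.eq_zero_or_eq_succ j with rfl | ⟨j, rfl⟩
  · rw [Fin.le_zero_iff.1 hij]
  · simp [oneRow]

/-- The Cauchy–Binet expansion of the polynomial `τ(s) ŵ_k^{(0)}(s)` at power sums. -/
theorem restrictTimes_boundaryPoly {r M : ℕ} (hn : n = m + ((r : ℤ) + 1) + M) (k : Fin (M + 1))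
    (u v : Fin (r + 1) → ℂ) :
    restrictTimes u v (boundaryPoly hn k) = ∑ lam ∈ boxPartitions (r + 1) M,
      schur lam (fun j => u j ^ 2) * skewSchur lam (oneRow r k) (fun j => (v j ^ 2)⁻¹) := by
  have hD : ((numTimes m n : ℕ) : ℤ) = n - m - 1 := by
    simp only [numTimes]
    omega
  have hn' : n = m + ((r + 1 : ℕ) : ℤ) + M := by
    push_cast
    exact hn
  have hcb := cauchyBinet_boxPartitions hn'
    (fun i l => completeSymm (fun j => u j ^ 2) (l - (m + ((r : ℤ) - i))))
    (fun j l => completeSymm (fun j => (v j ^ 2)⁻¹) (l - (m + oneRow r k j + ((r : ℤ) - j))))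
  rw [restrictTimes, ← MvPolynomial.coe_aeval_eq_eval, RingHom.coe_coe, boundaryPoly,
    AlgHom.map_det]
  refine Eq.trans ?_ (hcb.trans ?_)
  · congr 1
    ext i j
    rw [AlgHom.mapMatrix_apply, Matrix.map_apply, Matrix.submatrix_apply, polyMatrix,
      map_timeMatrix, timeMatrix, Matrix.of_apply, Matrix.of_apply]
    refine Finset.sum_congr rfl fun l _ => ?_
    have hl1 := l.2.1
    have hl2 := l.2.2
    have hi := (partIdx hn (fun _ => 0) (fun _ => Nat.zero_le _) i).2.1
    have hj := (partIdx hn (oneRow r k) (oneRow_le k) j).2.1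
    simp only [map_neg, MvPolynomial.aeval_X, Sum.elim_inl, Sum.elim_inr, Pi.neg_apply, neg_neg]
    rw [intCoeff_timeExp_powerTimes _ _ (by omega), intCoeff_timeExp_powerTimes _ _ (by omega)]
    simp only [partIdx, Nat.cast_zero, add_zero]
  · refine Finset.sum_congr rfl fun lam _ => ?_
    congr 1
    · rw [schur, skewSchur, ← Matrix.det_transpose]
      congr 1
      ext i j
      simp only [Matrix.transpose_apply, Matrix.of_apply]
      congr 1
      push_cast
      ring
    · rw [skewSchur]
      congr 1
      ext i j
      simp only [Matrix.of_apply]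
      congr 1
      push_cast
      ring

end WaveMatrices

/-! ### Matrix elements of the monodromy matrix -/

section Monodromy

variable {M : ℕ}

theorem phi_apply (j : Fin (M + 1)) (x : Fock M) (occ : Fin (M + 1) → ℕ) :
    phi j x occ = x (Function.update occ j (occ j + 1)) := by
  classical
  induction x using Finsupp.induction_linear with
  | zero => simp
  | add x y hx hy => rw [map_add, Finsupp.add_apply, hx, hy, Finsupp.add_apply]
  | single a c =>
    rw [phi, Finsupp.linearCombination_single]
    by_cases ha : a j = 0
    · rw [if_pos ha, smul_zero, Finsupp.zero_apply, Finsupp.single_apply, if_neg]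
      intro h
      have := congrFun h j
      rw [Function.update_self] at this
      omega
    · rw [if_neg ha, Finsupp.smul_single_one, Finsupp.single_apply, Finsupp.single_apply]
      congr 1
      apply propext
      constructor
      · rintro rfl
        simp [Nat.sub_add_cancel (Nat.pos_of_ne_zero ha)]
      · rintro rfl
        simp

theorem phiDag_apply (j : Fin (M + 1)) (x : Fock M) (occ : Fin (M + 1) → ℕ) :
    phiDag j x occ = if occ j = 0 then 0 else x (Function.update occ j (occ j - 1)) := by
  classical
  induction x using Finsupp.induction_linear with
  | zero => simp
  | add x y hx hy =>
    rw [map_add, Finsupp.add_apply, hx, hy, Finsupp.add_apply]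
    split <;> simp
  | single a c =>
    rw [phiDag, Finsupp.linearCombination_single, Finsupp.smul_single_one]
    by_cases ho : occ j = 0
    · rw [if_pos ho, Finsupp.single_apply, if_neg]
      rintro rfl
      simp at ho
    · rw [if_neg ho, Finsupp.single_apply, Finsupp.single_apply]
      congr 1
      apply propext
      constructor
      · rintro rfl
        simp
      · rintro rfl
        simp [Nat.sub_add_cancel (Nat.pos_of_ne_zero ho)]

/-- The matrix element of the local `L`-operator between occupation numbers differing by `d`. -/
def siteMatrix (u : ℂ) (d : ℤ) : Matrix (Fin 2) (Fin 2) ℂ :=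
  Matrix.of fun a c => if (c : ℤ) = (a : ℤ) + d then u ^ ((a : ℤ) + (c : ℤ) - 1) else 0

/-- Exchanging the two states of the auxiliary space inverts `u` and transposes the site. -/
theorem siteMatrix_inv (u : ℂ) (d : ℤ) (a c : Fin 2) :
    siteMatrix u d a c = siteMatrix u⁻¹ (-d) a.rev c.rev := by
  simp only [siteMatrix, Matrix.of_apply]
  fin_cases a <;> fin_cases c <;> simp <;> congr 1 <;> apply propext <;> constructor <;> intro h <;>
    omega

/-- Matrix elements of a product of local `L`-operators at distinct sites factorize. -/
theorem prod_Lop_apply (u : ℂ) (l : List (Fin (M + 1))) (hl : l.Nodup)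
    (occ occ' : Fin (M + 1) → ℕ) (a b : Fin 2) [Decidable (∀ j ∉ l, occ' j = occ j)] :
    (l.map (Lop u)).prod a b (Finsupp.single occ 1) occ' =
      if ∀ j ∉ l, occ' j = occ j then
        (l.map fun j => siteMatrix u ((occ' j : ℤ) - occ j)).prod a b else 0 := by
  classical
  induction l generalizing occ' a with
  | nil =>
    simp only [List.map_nil, List.prod_nil, Matrix.one_apply]
    by_cases hab : a = b
    · rw [if_pos hab, if_pos hab, Module.End.one_apply, Finsupp.single_apply]
      congr 1
      apply propext
      simp [funext_iff, eq_comm]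
    · simp [hab]
  | cons j l ih =>
    obtain ⟨hj, hl⟩ := List.nodup_cons.1 hl
    -- the sites in `l` do not see the occupation number of `j`, which must stay equal to `occ j`
    have key : ∀ (c : Fin 2) (q : ℕ),
        (l.map (Lop u)).prod c b (Finsupp.single occ 1) (Function.update occ' j q) =
          if q = occ j ∧ ∀ i ∉ j :: l, occ' i = occ i then
            (l.map fun j => siteMatrix u ((occ' j : ℤ) - occ j)).prod c b else 0 := by
      intro c q
      rw [ih hl]
      have hlist : (l.map fun i => siteMatrix u ((Function.update occ' j q i : ℤ) - occ i)) =
          l.map fun i => siteMatrix u ((occ' i : ℤ) - occ i) := by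
        refine List.map_congr_left fun i hi => ?_
        rw [Function.update_of_ne (by rintro rfl; exact hj hi)]
      have hcond : (∀ i ∉ l, Function.update occ' j q i = occ i) ↔
          (q = occ j ∧ ∀ i ∉ j :: l, occ' i = occ i) := by
        constructor
        · intro h
          refine ⟨by simpa using h j hj, fun i hi => ?_⟩
          rw [List.mem_cons, not_or] at hi
          simpa [hi.1] using h i hi.2
        · rintro ⟨h1, h2⟩ i hi
          by_cases hij : i = j
          · subst hij
            simpa using h1
          · rw [Function.update_of_ne hij]
            exact h2 i (by simp [hij, hi])
      simp only [hlist, hcond]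
    have key0 : ∀ c : Fin 2, (l.map (Lop u)).prod c b (Finsupp.single occ 1) occ' =
          if occ' j = occ j ∧ ∀ i ∉ j :: l, occ' i = occ i then
            (l.map fun j => siteMatrix u ((occ' j : ℤ) - occ j)).prod c b else 0 := by
      intro c
      rw [← key, Function.update_eq_self]
    simp only [List.map_cons, List.prod_cons, Matrix.mul_apply, Fin.sum_univ_two]
    have h00 : Lop u j 0 0 = u⁻¹ • 1 := rfl
    have h01 : Lop u j 0 1 = phiDag j := rfl
    have h10 : Lop u j 1 0 = phi j := rfl
    have h11 : Lop u j 1 1 = u • 1 := rfl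
    rw [LinearMap.add_apply, Finsupp.add_apply, Module.End.mul_apply, Module.End.mul_apply]
    by_cases hc : ∀ i ∉ j :: l, occ' i = occ i
    · rw [if_pos hc]
      simp only [eq_true hc, and_true] at key key0
      obtain rfl | rfl : a = 0 ∨ a = 1 := by omega
      · rw [h00, h01, LinearMap.smul_apply, Module.End.one_apply, Finsupp.smul_apply, phiDag_apply,
          key, key0, siteMatrix, Matrix.of_apply, Matrix.of_apply, smul_eq_mul]
        simp only [Fin.val_zero, Nat.cast_zero, Fin.val_one, Nat.cast_one, zero_add, zero_sub,
          add_zero, zpow_neg_one, sub_self, zpow_zero]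
        congr 1
        · by_cases h : occ' j = occ j
          · simp [h]
          · rw [if_neg h, if_neg (by omega), mul_zero, zero_mul]
        · by_cases h : occ' j = occ j + 1
          · simp [h]
          · rw [if_neg (show ¬ (1 : ℤ) = (occ' j : ℤ) - occ j by omega), zero_mul]
            split_ifs <;> first | rfl | omega
      · rw [h10, h11, LinearMap.smul_apply, Module.End.one_apply, Finsupp.smul_apply, phi_apply,
          key, key0, siteMatrix, Matrix.of_apply, Matrix.of_apply, smul_eq_mul]
        simp only [Fin.val_zero, Nat.cast_zero, Fin.val_one, Nat.cast_one, add_zero, sub_self,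
          zpow_zero, add_sub_cancel_right, zpow_one]
        congr 1
        · by_cases h : occ' j + 1 = occ j
          · rw [if_pos h, if_pos (by omega), one_mul]
          · rw [if_neg h, if_neg (by omega), zero_mul]
        · by_cases h : occ' j = occ j
          · simp [h]
          · rw [if_neg h, if_neg (by omega), mul_zero, zero_mul]
    · rw [if_neg hc]
      simp only [eq_false hc, and_false, if_false] at key key0
      obtain rfl | rfl : a = 0 ∨ a = 1 := by omega
      · simp [h00, h01, phiDag_apply, key, key0]
      · simp [h10, h11, phi_apply, key, key0]

theorem monodromy_apply (u : ℂ) (occ occ' : Fin (M + 1) → ℕ) (a b : Fin 2) :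
    monodromy M u a b (Finsupp.single occ 1) occ' =
      (List.ofFn fun j : Fin (M + 1) =>
        siteMatrix u ((occ' j.rev : ℤ) - occ j.rev)).prod a b := by
  classical
  have h := prod_Lop_apply u (List.ofFn (Fin.rev : Fin (M + 1) → Fin (M + 1)))
    (List.nodup_ofFn.2 Fin.rev_injective) occ occ' a b
  rw [List.map_ofFn, List.map_ofFn, if_pos] at h
  · exact h
  · intro j hj
    exact absurd (List.mem_ofFn.2 ⟨j.rev, Fin.rev_rev j⟩) hj

theorem prod_siteMatrix_inv (u : ℂ) (l : List ℤ) (a b : Fin 2) :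
    (l.map (siteMatrix u)).prod a b = (l.map fun d => siteMatrix u⁻¹ (-d)).prod a.rev b.rev := by
  induction l generalizing a with
  | nil => simp [Matrix.one_apply, Fin.rev_inj]
  | cons d l ih =>
    simp only [List.map_cons, List.prod_cons, Matrix.mul_apply]
    refine Fintype.sum_equiv Fin.revPerm _ _ fun c => ?_
    rw [siteMatrix_inv, ih]
    rfl

/-- `C(u)` is the transpose of `B(u⁻¹)`. -/
theorem opC_single_apply (u : ℂ) (occ occ' : Fin (M + 1) → ℕ) :
    opC M u (Finsupp.single occ 1) occ' = opB M u⁻¹ (Finsupp.single occ' 1) occ := by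
  rw [opC, opB, monodromy_apply, monodromy_apply]
  have h := prod_siteMatrix_inv u
    (List.ofFn fun j : Fin (M + 1) => (occ' j.rev : ℤ) - occ j.rev) 1 0
  rw [List.map_ofFn, List.map_ofFn] at h
  refine h.trans ?_
  simp only [Function.comp_def, neg_sub]
  rfl

/-- The coefficients of `C(u) x` pair `x` with the image of a basis vector under `B(u⁻¹)`. -/
theorem opC_apply (u : ℂ) (x : Fock M) (occ : Fin (M + 1) → ℕ) :
    opC M u x occ = Finsupp.linearCombination ℂ x (opB M u⁻¹ (Finsupp.single occ 1)) := by
  induction x using Finsupp.induction_linear with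
  | zero => simp
  | add x y hx hy =>
    rw [map_add, Finsupp.add_apply, hx, hy]
    simp only [Finsupp.linearCombination_apply, Finsupp.sum, Finsupp.add_apply, smul_add,
      Finset.sum_add_distrib]
  | single a c =>
    classical
    rw [← Finsupp.smul_single_one, map_smul, Finsupp.smul_apply, opC_single_apply,
      Finsupp.linearCombination_apply, Finsupp.sum, Finset.sum_eq_single a]
    · simp [mul_comm]
    · intro b _ hb
      simp [hb.symm]
    · intro ha
      rw [Finsupp.notMem_support_iff.1 ha, zero_smul]

/-- A product of site matrices has only one nonzero path: along it, the auxiliary space is in the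
states `E 0, E 1, …`, which have to be `0` or `1`. -/
theorem prod_siteMatrix {u : ℂ} (hu : u ≠ 0) (d : ℕ) (E : ℕ → ℤ) (a b : Fin 2) (ha : E 0 = a)
    [Decidable ((∀ i ≤ d, 0 ≤ E i ∧ E i ≤ 1) ∧ E d = b)] :
    (List.ofFn fun i : Fin d => siteMatrix u (E (i + 1) - E i)).prod a b =
      if (∀ i ≤ d, 0 ≤ E i ∧ E i ≤ 1) ∧ E d = b then
        u ^ (∑ i ∈ Finset.range d, (E i + E (i + 1) - 1)) else 0 := by
  classical
  induction d generalizing E a with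
  | zero =>
    simp only [List.ofFn_zero, List.prod_nil, Matrix.one_apply, Finset.range_zero,
      Finset.sum_empty, zpow_zero]
    congr 1
    apply propext
    have ha2 := a.2
    constructor
    · rintro rfl
      refine ⟨fun i hi => ?_, ha⟩
      obtain rfl : i = 0 := by omega
      omega
    · rintro ⟨-, h⟩
      ext
      omega
  | succ d ih =>
    rw [List.ofFn_succ, List.prod_cons, Matrix.mul_apply]
    have ha2 := a.2
    by_cases h1 : 0 ≤ E 1 ∧ E 1 ≤ 1
    · obtain ⟨c, hc⟩ : ∃ c : Fin 2, E 1 = c := ⟨⟨(E 1).toNat, by omega⟩, by simp [h1.1]⟩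
      have ihc := ih (fun i => E (i + 1)) c hc
      rw [Finset.sum_eq_single c]
      · simp only [Fin.val_succ] at ihc ⊢
        rw [ihc]
        simp only [Fin.val_zero, zero_add, siteMatrix, Matrix.of_apply]
        rw [if_pos (by omega)]
        have hiff : ((∀ i ≤ d, 0 ≤ E (i + 1) ∧ E (i + 1) ≤ 1) ∧ E (d + 1) = b) ↔
            ((∀ i ≤ d + 1, 0 ≤ E i ∧ E i ≤ 1) ∧ E (d + 1) = b) := by
          refine and_congr_left fun _ => ⟨fun h i hi => ?_, fun h i hi => h _ (by omega)⟩
          rcases i with _ | i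
          · omega
          · exact h i (by omega)
        simp only [hiff]
        split_ifs
        · rw [Finset.sum_range_succ', ← zpow_add₀ hu]
          congr 1
          rw [zero_add, ha, hc]
          ring
        · rw [mul_zero]
      · intro c' _ hne
        rw [siteMatrix, Matrix.of_apply, if_neg, zero_mul]
        intro h
        apply hne
        ext
        simp only [Fin.val_zero, zero_add] at h
        omega
      · simp
    · rw [if_neg (fun h => h1 (h.1 1 (by omega)))]
      refine Finset.sum_eq_zero fun c _ => ?_
      have hc := c.2
      rw [siteMatrix, Matrix.of_apply, if_neg, zero_mul]
      simp only [Fin.val_zero, zero_add]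
      omega

/-- The number of particles at the sites `q, …, M`. -/
def tailSum (occ : Fin (M + 1) → ℕ) (q : ℕ) : ℕ := ∑ j : Fin (M + 1), if q ≤ j then occ j else 0

theorem tailSum_eq_add (occ : Fin (M + 1) → ℕ) (j : Fin (M + 1)) :
    tailSum occ j = occ j + tailSum occ (j + 1) := by
  rw [tailSum, tailSum, ← Finset.add_sum_erase _ _ (Finset.mem_univ j),
    ← Finset.add_sum_erase (a := j) _ (fun i : Fin (M + 1) => if (j : ℕ) + 1 ≤ i then occ i else 0)
      (Finset.mem_univ j), if_pos le_rfl, if_neg (by omega), zero_add]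
  congr 1
  refine Finset.sum_congr rfl fun i hi => ?_
  have hne : (i : ℕ) ≠ j := fun h => (Finset.mem_erase.1 hi).1 (Fin.ext h)
  congr 1
  apply propext
  omega

theorem tailSum_top (occ : Fin (M + 1) → ℕ) : tailSum occ (M + 1) = 0 :=
  Finset.sum_eq_zero fun j _ => if_neg (by have := j.2; omega)

theorem tailSum_anti (occ : Fin (M + 1) → ℕ) : Antitone (tailSum occ) := by
  intro p q hpq
  refine Finset.sum_le_sum fun j _ => ?_
  split_ifs <;> omega

/-- Matrix elements of `B(u)` in terms of the numbers of particles at the last sites. -/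
theorem opB_single_apply {u : ℂ} (hu : u ≠ 0) (occ occ' : Fin (M + 1) → ℕ)
    [Decidable ((∀ q ≤ M, tailSum occ q ≤ tailSum occ' q ∧ tailSum occ' q ≤ tailSum occ q + 1) ∧
      tailSum occ' 0 = tailSum occ 0 + 1)] :
    opB M u (Finsupp.single occ 1) occ' =
      if (∀ q ≤ M, tailSum occ q ≤ tailSum occ' q ∧ tailSum occ' q ≤ tailSum occ q + 1) ∧
        tailSum occ' 0 = tailSum occ 0 + 1 then
        u ^ (2 * (∑ q ∈ Finset.range (M + 1),
          ((tailSum occ' (q + 1) : ℤ) - tailSum occ (q + 1))) - M)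
      else 0 := by
  classical
  -- `E i` is the state of the auxiliary space after the `i` leftmost factors, the sites `M + 1 - i`
  -- to `M`: particles are conserved
  set E : ℕ → ℤ := fun i => (tailSum occ' (M + 1 - i) : ℤ) - tailSum occ (M + 1 - i) with hE
  have hE0 : E 0 = ((0 : Fin 2) : ℕ) := by simp [hE, tailSum_top]
  have h := prod_siteMatrix hu (M + 1) E 0 1 hE0
  have hlist : (fun j : Fin (M + 1) => siteMatrix u ((occ' j.rev : ℤ) - occ j.rev)) =
      fun i : Fin (M + 1) => siteMatrix u (E (i + 1) - E i) := by
    funext i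
    have h1 := tailSum_eq_add occ i.rev
    have h2 := tailSum_eq_add occ' i.rev
    rw [Fin.val_rev] at h1 h2
    have hi := i.2
    rw [show M + 1 - ((i : ℕ) + 1) + 1 = M + 1 - i by omega] at h1 h2
    simp only [hE]
    congr 1
    omega
  have hiff : ((∀ i ≤ M + 1, 0 ≤ E i ∧ E i ≤ 1) ∧ E (M + 1) = ((1 : Fin 2) : ℕ)) ↔
      (∀ q ≤ M, tailSum occ q ≤ tailSum occ' q ∧ tailSum occ' q ≤ tailSum occ q + 1) ∧
        tailSum occ' 0 = tailSum occ 0 + 1 := by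
    simp only [hE, Nat.sub_self, Fin.val_one, Nat.cast_one]
    refine and_congr ⟨fun h q hq => ?_, fun h i hi => ?_⟩ (by omega)
    · have := h (M + 1 - q) (by omega)
      rw [show M + 1 - (M + 1 - q) = q by omega] at this
      omega
    · rcases i with _ | i
      · simp [tailSum_top]
      · have := h (M + 1 - (i + 1)) (by omega)
        omega
  rw [opB, monodromy_apply, hlist, h]
  simp only [hiff]
  split_ifs with hc
  · congr 1
    have hs : ∑ i ∈ Finset.range (M + 1), E i = ∑ q ∈ Finset.range (M + 1),
        ((tailSum occ' (q + 1) : ℤ) - tailSum occ (q + 1)) := by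
      rw [← Finset.sum_range_reflect]
      refine Finset.sum_congr rfl fun q hq => ?_
      rw [Finset.mem_range] at hq
      simp only [hE]
      rw [show M + 1 - (M + 1 - 1 - q) = q + 1 by omega]
    have hs' : ∑ i ∈ Finset.range (M + 1), E (i + 1) = ∑ i ∈ Finset.range (M + 1), E i + 1 := by
      have h1 := Finset.sum_range_succ E (M + 1)
      have h2 := Finset.sum_range_succ' E (M + 1)
      have h3 : E (M + 1) = 1 := by
        simp only [hE, Nat.sub_self]
        omega
      rw [hE0] at h2
      simp only [Fin.val_zero, Nat.cast_zero, add_zero] at h2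
      rw [← h2, h1, h3]
    rw [Finset.sum_sub_distrib, Finset.sum_add_distrib, hs', hs]
    simp only [Finset.sum_const, Finset.card_range, nsmul_eq_mul, mul_one]
    push_cast
    ring
  · rfl

end Monodromy

/-! ### Partitions as states of the phase model -/

section Kets

variable {N M : ℕ}

/-- The number of the first `p` parts of `lam` that are at least `q`. -/
def partCount (lam : Fin N → ℕ) (p q : ℕ) : ℕ := Finset.card {i : Fin N | (i : ℕ) < p ∧ q ≤ lam i}

/-- The occupation numbers of the first `p` parts of `lam`: site `j` holds one particle for each
part equal to `j`. -/
def occupation (M : ℕ) (lam : Fin N → ℕ) (p : ℕ) : Fin (M + 1) → ℕ := fun j =>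
  Finset.card {i : Fin N | (i : ℕ) < p ∧ lam i = j}

/-- An initial segment of `Fin N` is determined by its cardinality. -/
theorem lt_card_filter_iff {P : Fin N → Prop} [DecidablePred P]
    (hP : ∀ i j, i ≤ j → P j → P i) (i : Fin N) : (i : ℕ) < Finset.card {j | P j} ↔ P i := by
  constructor
  · intro h
    by_contra hi
    have hsub : ({j | P j} : Finset (Fin N)) ⊆ Finset.Iio i := by
      intro j hj
      rw [Finset.mem_filter_univ] at hj
      rw [Finset.mem_Iio]
      by_contra hij
      exact hi (hP i j (not_lt.1 hij) hj)
    have := Finset.card_le_card hsub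
    rw [Fin.card_Iio] at this
    omega
  · intro h
    have hsub : Finset.Iic i ⊆ ({j | P j} : Finset (Fin N)) := by
      intro j hj
      rw [Finset.mem_filter_univ]
      exact hP j i (Finset.mem_Iic.1 hj) h
    have := Finset.card_le_card hsub
    rw [Fin.card_Iic] at this
    omega

theorem lt_partCount_iff {lam : Fin N → ℕ} (hlam : Antitone lam) (p q : ℕ) (i : Fin N) :
    (i : ℕ) < partCount lam p q ↔ (i : ℕ) < p ∧ q ≤ lam i := by
  refine lt_card_filter_iff (P := fun i : Fin N => (i : ℕ) < p ∧ q ≤ lam i) ?_ i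
  intro i j hij ⟨h1, h2⟩
  rw [Fin.le_def] at hij
  exact ⟨by omega, h2.trans (hlam (by rw [Fin.le_def]; exact hij))⟩

theorem partCount_le (lam : Fin N → ℕ) (p q : ℕ) : partCount lam p q ≤ N :=
  (Finset.card_filter_le _ _).trans (by simp)

theorem partCount_zero (lam : Fin N → ℕ) {p : ℕ} (hp : p ≤ N) : partCount lam p 0 = p := by
  have h : ({i : Fin N | (i : ℕ) < p ∧ 0 ≤ lam i} : Finset (Fin N)) =
      Finset.univ.filter fun i : Fin N => (i : ℕ) < p := by
    ext; simp
  rw [partCount, h, Fin.card_filter_val_lt, min_eq_right hp]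

theorem tailSum_occupation {lam : Fin N → ℕ} (hM : ∀ i, lam i ≤ M) (p q : ℕ) :
    tailSum (occupation M lam p) q = partCount lam p q := by
  simp only [tailSum, occupation, partCount, Finset.card_filter]
  have h : ∀ j : Fin (M + 1), (if q ≤ (j : ℕ) then
      ∑ i : Fin N, (if (i : ℕ) < p ∧ lam i = j then 1 else 0) else 0) =
      ∑ i : Fin N, if q ≤ (j : ℕ) ∧ (i : ℕ) < p ∧ lam i = j then 1 else 0 := by
    intro j
    split_ifs with h <;> simp [h]
  simp only [h]
  rw [Finset.sum_comm]
  refine Finset.sum_congr rfl fun i _ => ?_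
  rw [Finset.sum_eq_single (⟨lam i, by have := hM i; omega⟩ : Fin (M + 1))]
  · congr 1
    apply propext
    simp only
    tauto
  · intro j _ hj
    rw [if_neg]
    rintro ⟨-, -, h⟩
    exact hj (Fin.ext h.symm)
  · simp

/-- The numbers of particles at the last sites determine a state. -/
theorem eq_of_tailSum_eq {occ occ' : Fin (M + 1) → ℕ}
    (h : ∀ q ≤ M, tailSum occ q = tailSum occ' q) : occ = occ' := by
  funext j
  have h1 := tailSum_eq_add occ j
  have h2 := tailSum_eq_add occ' j
  have h3 := h j (by omega)
  have h4 : tailSum occ (j + 1) = tailSum occ' (j + 1) := by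
    rcases Nat.lt_or_ge M (j + 1) with hj | hj
    · rw [show (j : ℕ) + 1 = M + 1 by omega, tailSum_top, tailSum_top]
    · exact h _ hj
  omega

theorem occupation_injective {lam mu : Fin N → ℕ} (hlam : lam ∈ boxPartitions N M)
    (hmu : mu ∈ boxPartitions N M) {p : ℕ} (hlamp : ∀ i : Fin N, p ≤ i → lam i = 0)
    (hmup : ∀ i : Fin N, p ≤ i → mu i = 0) (h : occupation M lam p = occupation M mu p) :
    lam = mu := by
  obtain ⟨hl1, hl2⟩ := mem_boxPartitions.1 hlam
  obtain ⟨hm1, hm2⟩ := mem_boxPartitions.1 hmu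
  have hcount : ∀ q, partCount lam p q = partCount mu p q := fun q => by
    rw [← tailSum_occupation hl1, ← tailSum_occupation hm1, h]
  funext i
  rcases Nat.lt_or_ge i p with hi | hi
  · have h1 := (lt_partCount_iff hl2 p (lam i) i).2 ⟨hi, le_rfl⟩
    have h2 := (lt_partCount_iff hm2 p (mu i) i).2 ⟨hi, le_rfl⟩
    rw [hcount] at h1
    rw [← hcount] at h2
    exact le_antisymm ((lt_partCount_iff hm2 _ _ _).1 h1).2 ((lt_partCount_iff hl2 _ _ _).1 h2).2
  · rw [hlamp i hi, hmup i hi]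

/-- Every state with `p ≤ N` particles comes from a partition: its conjugate has the columns
`tailSum occ q`. -/
theorem exists_occupation_eq (occ : Fin (M + 1) → ℕ) {p : ℕ} (hp : p ≤ N)
    (hocc : tailSum occ 0 = p) :
    ∃ lam ∈ boxPartitions N M, (∀ i : Fin N, p ≤ i → lam i = 0) ∧ occupation M lam p = occ := by
  let lam : Fin N → ℕ := fun i => Finset.card {q : Fin M | (i : ℕ) < tailSum occ (q + 1)}
  have hle : ∀ i q, q ≤ M → q ≠ 0 → (q ≤ lam i ↔ (i : ℕ) < tailSum occ q) := by
    intro i q hq hq0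
    obtain ⟨q, rfl⟩ := Nat.exists_eq_succ_of_ne_zero hq0
    exact lt_card_filter_iff (P := fun q : Fin M => (i : ℕ) < tailSum occ (q + 1))
      (fun a b hab h => h.trans_le (tailSum_anti occ (by rw [Fin.le_def] at hab; omega)))
      ⟨q, by omega⟩
  have hM : ∀ i, lam i ≤ M := fun i => by
    simpa using Finset.card_filter_le (Finset.univ : Finset (Fin M)) _
  have hanti : Antitone lam := fun i j hij => by
    refine Finset.card_le_card fun q hq => ?_
    rw [Finset.mem_filter_univ] at hq ⊢
    rw [Fin.le_def] at hij
    omega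
  refine ⟨lam, mem_boxPartitions.2 ⟨hM, hanti⟩, fun i hi => ?_, ?_⟩
  · rw [Finset.card_eq_zero, Finset.filter_eq_empty_iff]
    intro q _
    have := tailSum_anti occ (Nat.zero_le ((q : ℕ) + 1))
    omega
  · apply eq_of_tailSum_eq
    intro q hq
    rw [tailSum_occupation hM]
    rcases Nat.eq_zero_or_pos q with rfl | hq0
    · rw [partCount_zero _ hp, hocc]
    · have hle' : tailSum occ q ≤ p := hocc ▸ tailSum_anti occ (Nat.zero_le q)
      have hset : ({i : Fin N | (i : ℕ) < p ∧ q ≤ lam i} : Finset (Fin N)) =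
          Finset.univ.filter fun i : Fin N => (i : ℕ) < tailSum occ q := by
        ext i
        rw [Finset.mem_filter_univ, Finset.mem_filter_univ, hle i q hq hq0.ne']
        omega
      rw [partCount, hset, Fin.card_filter_val_lt, min_eq_right (hle'.trans hp)]

/-- Horizontal strips are characterized by the lengths of the columns. -/
theorem interlaces_iff {lam mu : Fin N → ℕ} (hlam : lam ∈ boxPartitions N M)
    (hmu : mu ∈ boxPartitions N M) {p : ℕ} (hlamp : ∀ i : Fin N, p + 1 ≤ i → lam i = 0)
    (hmup : ∀ i : Fin N, p ≤ i → mu i = 0) :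
    Interlaces lam mu ↔ ∀ q ≤ M, partCount mu p q ≤ partCount lam (p + 1) q ∧
      partCount lam (p + 1) q ≤ partCount mu p q + 1 := by
  obtain ⟨hl1, hl2⟩ := mem_boxPartitions.1 hlam
  obtain ⟨hm1, hm2⟩ := mem_boxPartitions.1 hmu
  constructor
  · rintro ⟨h1, h2⟩ q hq
    constructor
    · refine Finset.card_le_card fun i hi => ?_
      rw [Finset.mem_filter_univ] at hi ⊢
      exact ⟨by omega, hi.2.trans (h1 i)⟩
    · by_contra hlt
      have hN := partCount_le lam (p + 1) q
      have h3 := (lt_partCount_iff hl2 (p + 1) q ⟨partCount mu p q + 1, by omega⟩).1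
        (by simp only; omega)
      simp only at h3
      have h4 := h2 ⟨partCount mu p q, by omega⟩ ⟨partCount mu p q + 1, by omega⟩
        (by rw [Fin.lt_def]; simp)
      have h5 := (lt_partCount_iff hm2 p q ⟨partCount mu p q, by omega⟩).2
        ⟨by simp only; omega, h3.2.trans h4⟩
      simp only at h5
      omega
  · intro h
    constructor
    · intro i
      rcases Nat.lt_or_ge i p with hi | hi
      · have h1 := (lt_partCount_iff hm2 p (mu i) i).2 ⟨hi, le_rfl⟩
        exact ((lt_partCount_iff hl2 (p + 1) (mu i) i).1 (h1.trans_le (h _ (hm1 i)).1)).2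
      · rw [hmup i hi]
        exact Nat.zero_le _
    · intro i j hij
      rw [Fin.lt_def] at hij
      rcases Nat.lt_or_ge j (p + 1) with hj | hj
      · have h1 := (lt_partCount_iff hl2 (p + 1) (lam j) j).2 ⟨hj, le_rfl⟩
        have h2 := (h _ (hl1 j)).2
        exact ((lt_partCount_iff hm2 p (lam j) i).1 (by omega)).2
      · rw [hlamp j hj]
        exact Nat.zero_le _

theorem sum_partCount {lam : Fin N → ℕ} (hM : ∀ i, lam i ≤ M) {p : ℕ}
    (hp : ∀ i : Fin N, p ≤ i → lam i = 0) :
    ∑ q ∈ Finset.range (M + 1), partCount lam p (q + 1) = ∑ i, lam i := by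
  simp only [partCount, Finset.card_filter]
  rw [Finset.sum_comm]
  refine Finset.sum_congr rfl fun i _ => ?_
  rw [← Finset.card_filter]
  have hset : (Finset.range (M + 1)).filter (fun q => (i : ℕ) < p ∧ q + 1 ≤ lam i) =
      Finset.range (lam i) := by
    ext q
    have := hM i
    have := hp i
    simp only [Finset.mem_filter, Finset.mem_range]
    omega
  rw [hset, Finset.card_range]

/-- The creation operator adds horizontal strips. -/
theorem opB_single_occupation {u : ℂ} (hu : u ≠ 0) {mu : Fin N → ℕ}
    (hmu : mu ∈ boxPartitions N M) {p : ℕ} (hp : p + 1 ≤ N)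
    (hmup : ∀ i : Fin N, p ≤ i → mu i = 0) :
    opB M u (Finsupp.single (occupation M mu p) 1) =
      (u ^ M)⁻¹ • ∑ lam ∈ boxPartitions N M, skewSchur lam mu (fun _ : Fin 1 => u ^ 2) •
        Finsupp.single (occupation M lam (p + 1)) 1 := by
  classical
  obtain ⟨hm1, hm2⟩ := mem_boxPartitions.1 hmu
  have hstrip : ∀ lam ∈ boxPartitions N M, skewSchur lam mu (fun _ : Fin 1 => u ^ 2) ≠ 0 →
      ∀ i : Fin N, p + 1 ≤ i → lam i = 0 := by
    intro lam hlam h i hi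
    have := (le_of_skewSchur_ne_zero hlam hmu _ h).2 ⟨i - 1, by omega⟩ i (by simp only; omega)
    rw [hmup _ (by simp only; omega)] at this
    omega
  ext occ'
  rw [opB_single_apply hu, Finsupp.smul_apply, Finsupp.finsetSum_apply]
  simp only [Finsupp.smul_apply, Finsupp.single_apply, smul_eq_mul, mul_ite, mul_one, mul_zero]
  simp only [tailSum_occupation hm1, partCount_zero mu (show p ≤ N by omega)]
  by_cases htot : tailSum occ' 0 = p + 1
  · obtain ⟨lam, hlam, hlamp, rfl⟩ := exists_occupation_eq occ' hp htot
    obtain ⟨hl1, hl2⟩ := mem_boxPartitions.1 hlam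
    rw [Finset.sum_eq_single_of_mem lam hlam, if_pos rfl, skewSchur_single _ _ hl2 hm2]
    · simp only [tailSum_occupation hl1, partCount_zero lam hp, and_true,
        ← interlaces_iff hlam hmu hlamp hmup]
      split_ifs with hint
      · have hsum : ∑ q ∈ Finset.range (M + 1), ((partCount lam (p + 1) (q + 1) : ℤ) -
            partCount mu p (q + 1)) = ((∑ i, (lam i - mu i) : ℕ) : ℤ) := by
          rw [Finset.sum_sub_distrib, ← Nat.cast_sum, ← Nat.cast_sum, sum_partCount hl1 hlamp,
            sum_partCount hm1 hmup]
          push_cast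
          rw [← Finset.sum_sub_distrib]
          exact Finset.sum_congr rfl fun i _ => by rw [Nat.cast_sub (hint.1 i)]
        rw [hsum, zpow_sub₀ hu, zpow_natCast, Finset.prod_pow_eq_pow_sum, ← pow_mul, div_eq_inv_mul]
        congr 1
      · rw [mul_zero]
    · intro nu hnu hne
      split_ifs with h
      · by_contra h0
        exact hne (occupation_injective hnu hlam (hstrip nu hnu h0) hlamp h)
      · rfl
  · rw [if_neg (fun h => htot h.2), Finset.sum_eq_zero, mul_zero]
    intro lam hlam
    rw [if_neg]
    rintro rfl
    exact htot (by rw [tailSum_occupation (mem_boxPartitions.1 hlam).1, partCount_zero lam hp])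

/-- Adding `s` horizontal strips adds at most `s` nonzero parts. -/
theorem eq_zero_of_skewSchur_ne_zero {lam mu : Fin N → ℕ} (hlam : lam ∈ boxPartitions N M)
    (hmu : mu ∈ boxPartitions N M) {p s : ℕ} (hmup : ∀ i : Fin N, p ≤ i → mu i = 0)
    (z : Fin s → ℂ) (h : skewSchur lam mu z ≠ 0) (i : Fin N) (hi : p + s ≤ i) : lam i = 0 := by
  have := (le_of_skewSchur_ne_zero hlam hmu z h).2 ⟨i - s, by omega⟩ i (by simp only; omega)
  rw [hmup _ (by simp only; omega)] at this
  omega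

/-- A product of creation operators has skew Schur polynomials as matrix elements. -/
theorem prod_opB_occupation {s : ℕ} (u : Fin s → ℂ) (hu : ∀ i, u i ≠ 0) {mu : Fin N → ℕ}
    (hmu : mu ∈ boxPartitions N M) {p : ℕ} (hp : p + s ≤ N)
    (hmup : ∀ i : Fin N, p ≤ i → mu i = 0) :
    (List.ofFn fun i => opB M (u i)).prod (Finsupp.single (occupation M mu p) 1) =
      ((∏ i, u i) ^ M)⁻¹ • ∑ lam ∈ boxPartitions N M, skewSchur lam mu (fun i => u i ^ 2) •
        Finsupp.single (occupation M lam (p + s)) 1 := by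
  induction s with
  | zero =>
    rw [List.ofFn_zero, List.prod_nil, Module.End.one_apply, Finset.sum_eq_single_of_mem mu hmu]
    · rw [skewSchur_empty (mem_boxPartitions.1 hmu).2 (mem_boxPartitions.1 hmu).2, if_pos rfl]
      simp
    · intro lam hlam hne
      rw [skewSchur_empty (mem_boxPartitions.1 hlam).2 (mem_boxPartitions.1 hmu).2, if_neg hne,
        zero_smul]
  | succ s ih =>
    have hz : (fun i => u i ^ 2) = Fin.cons (u 0 ^ 2) (fun i : Fin s => u i.succ ^ 2) := by
      funext i
      refine Fin.cases rfl (fun i => rfl) i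
    rw [List.ofFn_succ, List.prod_cons, Module.End.mul_apply,
      ih (fun i => u i.succ) (fun i => hu _) (by omega), map_smul, map_sum]
    have hterm : ∀ nu ∈ boxPartitions N M, opB M (u 0) (skewSchur nu mu (fun i => u i.succ ^ 2) •
        Finsupp.single (occupation M nu (p + s)) 1) = ((u 0) ^ M)⁻¹ • ∑ lam ∈ boxPartitions N M,
          (skewSchur lam nu (fun _ : Fin 1 => u 0 ^ 2) * skewSchur nu mu (fun i => u i.succ ^ 2)) •
            Finsupp.single (occupation M lam (p + (s + 1))) 1 := by
      intro nu hnu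
      by_cases h0 : skewSchur nu mu (fun i => u i.succ ^ 2) = 0
      · simp [h0]
      · rw [map_smul, opB_single_occupation (hu 0) hnu (by omega)
          (eq_zero_of_skewSchur_ne_zero hnu hmu hmup _ h0), smul_comm, Finset.smul_sum]
        simp only [smul_smul, mul_comm]
        rfl
    rw [Finset.sum_congr rfl hterm, ← Finset.smul_sum, Finset.sum_comm, smul_smul,
      Fin.prod_univ_succ, mul_pow, mul_inv, mul_comm]
    congr 1
    refine Finset.sum_congr rfl fun lam hlam => ?_
    rw [← Finset.sum_smul, hz, skewSchur_cons hlam hmu]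

/-- A product of annihilation operators removes horizontal strips. -/
theorem prod_opC_occupation {s : ℕ} (w : Fin s → ℂ) (hw : ∀ i, w i ≠ 0) {lam mu : Fin N → ℕ}
    (hlam : lam ∈ boxPartitions N M) (hmu : mu ∈ boxPartitions N M) {p : ℕ} (hp : p + s ≤ N)
    (hlamp : ∀ i : Fin N, p + s ≤ i → lam i = 0) (hmup : ∀ i : Fin N, p ≤ i → mu i = 0) :
    (List.ofFn fun i => opC M (w i)).prod (Finsupp.single (occupation M lam (p + s)) 1)
      (occupation M mu p) = (∏ i, w i) ^ M * skewSchur lam mu (fun i => (w i ^ 2)⁻¹) := by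
  classical
  induction s generalizing p mu with
  | zero =>
    rw [List.ofFn_zero, List.prod_nil, Module.End.one_apply, Finsupp.single_apply,
      skewSchur_empty (mem_boxPartitions.1 hlam).2 (mem_boxPartitions.1 hmu).2]
    simp only [Finset.univ_eq_empty, Finset.prod_empty, one_pow, one_mul]
    congr 1
    exact propext ⟨occupation_injective hlam hmu hlamp hmup, fun h => by rw [h]; rfl⟩
  | succ s ih =>
    have hz : (fun i => (w i ^ 2)⁻¹) =
        Fin.cons ((w 0 ^ 2)⁻¹) (fun i : Fin s => (w i.succ ^ 2)⁻¹) := by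
      funext i
      refine Fin.cases rfl (fun i => rfl) i
    rw [List.ofFn_succ, List.prod_cons, Module.End.mul_apply, opC_apply,
      opB_single_occupation (inv_ne_zero (hw 0)) hmu (by omega) hmup, map_smul, map_sum, hz,
      skewSchur_cons' hlam hmu, Fin.prod_univ_succ, mul_pow, inv_pow, inv_inv, smul_eq_mul,
      mul_assoc]
    congr 1
    rw [Finset.mul_sum]
    refine Finset.sum_congr rfl fun nu hnu => ?_
    rw [map_smul, Finsupp.linearCombination_single, one_smul, smul_eq_mul, inv_pow]
    by_cases h0 : skewSchur nu mu (fun _ : Fin 1 => (w 0 ^ 2)⁻¹) = 0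
    · simp [h0]
    · have := ih (fun i => w i.succ) (fun i => hw _) (p := p + 1) hnu (by omega)
        (fun i hi => hlamp i (by omega)) (eq_zero_of_skewSchur_ne_zero hnu hmu hmup _ h0)
      rw [show p + (s + 1) = p + 1 + s by omega, this]
      ring

end Kets

/-! ### The boundary correlation function -/

section BoundaryCorrelation

variable {r M : ℕ}

theorem occupation_oneRow (k : Fin (M + 1)) :
    occupation M (oneRow r k) 1 = Function.update (fun _ => 0) k 1 := by
  funext j
  have h : ({i : Fin (r + 1) | (i : ℕ) < 1 ∧ oneRow r k i = j} : Finset (Fin (r + 1))) =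
      if j = k then {0} else ∅ := by
    ext i
    refine Fin.cases ?_ (fun i => ?_) i
    · split_ifs with hj
      · simp [oneRow, hj]
      · have hne : ¬ (k : ℕ) = j := fun h => hj (Fin.ext h.symm)
        simp [oneRow, hne]
    · split_ifs <;> simp
  rw [occupation, h]
  by_cases hj : j = k
  · subst hj
    simp
  · simp [hj]

theorem boundaryCorrelation_eq (k : Fin (M + 1)) (u : Fin (r + 1) → ℂ) (w : Fin r → ℂ)
    (hu : ∀ j, u j ≠ 0) (hw : ∀ j, w j ≠ 0) :
    ((∏ j, u j) / ∏ j, w j) ^ M * boundaryCorrelation M k u w =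
      ∑ lam ∈ boxPartitions (r + 1) M,
        schur lam (fun j => u j ^ 2) * skewSchur lam (oneRow r k) (fun j => (w j ^ 2)⁻¹) := by
  have hzero : (fun _ => 0 : Fin (r + 1) → ℕ) ∈ boxPartitions (r + 1) M :=
    mem_boxPartitions.2 ⟨fun _ => Nat.zero_le _, fun _ _ _ => le_rfl⟩
  have hvac : (fun _ => 0 : Fin (M + 1) → ℕ) = occupation M (fun _ => 0 : Fin (r + 1) → ℕ) 0 := by
    funext j
    simp [occupation]
  have hone : ∀ i : Fin (r + 1), 1 ≤ (i : ℕ) → oneRow r k i = 0 := by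
    intro i
    refine Fin.cases (by simp) (fun i _ => by simp [oneRow]) i
  have hket : Function.update (fun _ => 0 : Fin (M + 1) → ℕ) k 1 = occupation M (oneRow r k) 1 :=
    (occupation_oneRow k).symm
  have hpu : (∏ j, u j) ^ M ≠ 0 := pow_ne_zero _ (Finset.prod_ne_zero_iff.2 fun j _ => hu j)
  have hpw : (∏ j, w j) ^ M ≠ 0 := pow_ne_zero _ (Finset.prod_ne_zero_iff.2 fun j _ => hw j)
  rw [boundaryCorrelation, vev, Module.End.mul_apply, Module.End.mul_apply, phi_apply, zero_add,
    hket]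
  nth_rewrite 1 [hvac]
  rw [prod_opB_occupation u hu hzero (by omega) (fun _ _ => rfl), map_smul, map_sum,
    Finsupp.smul_apply, Finsupp.finsetSum_apply, smul_eq_mul, Finset.mul_sum, Finset.mul_sum]
  refine Finset.sum_congr rfl fun lam hlam => ?_
  rw [map_smul, Finsupp.smul_apply, show 0 + (r + 1) = 1 + r by omega,
    prod_opC_occupation w hw hlam (oneRow_mem_boxPartitions k) (by omega)
      (fun i hi => absurd i.2 (by omega)) hone, smul_eq_mul, schur, div_pow]
  field_simp

/-- In `r` variables, only the partitions with last part at most `k` contribute. -/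
theorem sum_boxPartitions_eq_sum_boundaryPartitions (k : Fin (M + 1)) (z : Fin r → ℂ)
    (f : (Fin (r + 1) → ℕ) → ℂ) :
    ∑ lam ∈ boxPartitions (r + 1) M, f lam * skewSchur lam (oneRow r k) z =
      ∑ lam ∈ boundaryPartitions r M k, f lam * skewSchur lam (oneRow r k) z := by
  symm
  have hk := k.2
  refine Finset.sum_subset (fun lam h => ?_) (fun lam h hn => ?_)
  · rw [boundaryPartitions, Finset.mem_filter, Finset.mem_Icc] at h
    refine mem_boxPartitions.2 ⟨fun i => (h.1.2 i).trans ?_, h.2⟩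
    refine Fin.lastCases ?_ (fun i => ?_) i
    · simp [nearRectangle]
      omega
    · simp [nearRectangle]
  · by_contra h0
    apply hn
    obtain ⟨h1, h2⟩ := le_of_skewSchur_ne_zero h (oneRow_mem_boxPartitions k) z
      (right_ne_zero_of_mul h0)
    obtain ⟨h3, h4⟩ := mem_boxPartitions.1 h
    rw [boundaryPartitions, Finset.mem_filter, Finset.mem_Icc]
    refine ⟨⟨h1, fun i => ?_⟩, h4⟩
    refine Fin.lastCases ?_ (fun i => ?_) i
    · have := h2 0 (Fin.last r) (by simp)
      simpa [nearRectangle, oneRow] using this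
    · simpa [nearRectangle] using h3 i.castSucc

theorem tendsto_sum_schur_mul_skewSchur (k : Fin (M + 1)) (u : Fin (r + 1) → ℂ) (w : Fin r → ℂ) :
    Tendsto (fun v₁ : ℂ => ∑ lam ∈ boxPartitions (r + 1) M, schur lam (fun j => u j ^ 2) *
        skewSchur lam (oneRow r k) (fun j => ((Fin.cons v₁ w : Fin (r + 1) → ℂ) j ^ 2)⁻¹))
      (Bornology.cobounded ℂ)
      (𝓝 (∑ lam ∈ boxPartitions (r + 1) M, schur lam (fun j => u j ^ 2) *
        skewSchur lam (oneRow r k) (fun j => (w j ^ 2)⁻¹))) := by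
  refine tendsto_finsetSum _ fun lam _ => Tendsto.const_mul _ ?_
  rw [← skewSchur_cons_zero]
  refine ((continuous_skewSchur lam (oneRow r k)).tendsto _).comp ?_
  rw [tendsto_pi_nhds]
  intro j
  refine Fin.cases ?_ (fun j => ?_) j
  · simp only [Fin.cons_zero]
    have := (tendsto_inv₀_cobounded (α := ℂ)).pow 2
    simpa using this
  · simp only [Fin.cons_succ]
    exact tendsto_const_nhds

end BoundaryCorrelation

end

end TodaPhase

theorem mainTheorem2 (m n : ℤ) (r M : ℕ) (hn : n = m + ((r : ℤ) + 1) + (M : ℤ)) :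
    (∃! W : Matrix (TodaPhase.Idx m n) (TodaPhase.Idx m n) (TodaPhase.TimeField m n) ×
        Matrix (TodaPhase.Idx m n) (TodaPhase.Idx m n) (TodaPhase.TimeField m n),
      TodaPhase.IsWavePair 1 (TodaPhase.xVar m n) (TodaPhase.yVar m n) W.1 W.2) ∧
    ∀ Winf Wzero : Matrix (TodaPhase.Idx m n) (TodaPhase.Idx m n) (TodaPhase.TimeField m n),
      TodaPhase.IsWavePair 1 (TodaPhase.xVar m n) (TodaPhase.yVar m n) Winf Wzero →
      ∀ k : Fin (M + 1),
        ∃ P : TodaPhase.TimePoly m n,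
          algebraMap (TodaPhase.TimePoly m n) (TodaPhase.TimeField m n) P =
            TodaPhase.tau 1 (TodaPhase.xVar m n) (TodaPhase.yVar m n) (m + r) *
              Wzero ⟨m + r, Set.mem_Ico.2 ⟨by omega, by omega⟩⟩
                ⟨m + r + (k : ℕ), Set.mem_Ico.2 ⟨by omega, by omega⟩⟩ ∧
          ∀ (u : Fin (r + 1) → ℂ) (w : Fin r → ℂ), (∀ j, u j ≠ 0) → (∀ j, w j ≠ 0) →
            Tendsto
              (fun v₁ : ℂ => TodaPhase.restrictTimes u (Fin.cons v₁ w : Fin (r + 1) → ℂ) P)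
              (Bornology.cobounded ℂ)
              (𝓝 (∑ lam ∈ TodaPhase.boundaryPartitions r M k,
                TodaPhase.schur lam (fun j => u j ^ 2) *
                  TodaPhase.skewSchur lam (TodaPhase.oneRow r k) (fun j => (w j ^ 2)⁻¹))) ∧
            ∑ lam ∈ TodaPhase.boundaryPartitions r M k,
                TodaPhase.schur lam (fun j => u j ^ 2) *
                  TodaPhase.skewSchur lam (TodaPhase.oneRow r k) (fun j => (w j ^ 2)⁻¹) =
              ((∏ j, u j) / ∏ j, w j) ^ M * TodaPhase.boundaryCorrelation M k u w := by
  refine ⟨TodaPhase.existsUnique_isWavePair m n, fun Winf Wzero hW k =>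
    ⟨TodaPhase.boundaryPoly hn k, TodaPhase.algebraMap_boundaryPoly hn k hW _ _ rfl rfl,
      fun u w hu hw => ⟨?_, ?_⟩⟩⟩
  · rw [← TodaPhase.sum_boxPartitions_eq_sum_boundaryPartitions]
    simp only [TodaPhase.restrictTimes_boundaryPoly]
    exact TodaPhase.tendsto_sum_schur_mul_skewSchur k u w
  · rw [TodaPhase.boundaryCorrelation_eq k u w hu hw,
      TodaPhase.sum_boxPartitions_eq_sum_boundaryPartitions]
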